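/- Let $N\ge 2$, $0\le\lambda\le N$ and $c,\varepsilon\in\{-1,1\}$. Let $\mathbb{E}$ be $\mathbb{R}^{N+1}$ with its standard flat scalar product $g_0$ of index $\lambda$ if $c=1$ and of index $\lambda+1$ if $c=-1$, and let $\mathbb{M}^N_\lambda(c)$ be a connected component of $\{p\in\mathbb{E} : g_0(p,p)=c\}$, with the metric $g$ induced by $g_0$. Let $I\subset\mathbb{R}$ be an open interval, $a:I\to\mathbb{R}^+$ a smooth function, and let $\bar P=\varepsilon I\times_a\mathbb{M}^N_\lambda(c)$ be the product $I\times\mathbb{M}^N_\lambda(c)$ with the warped product metric $\langle\,,\rangle=\varepsilon\,dt^2+a(t)^2g$ and Levi-Civita connection $\bar\nabla$. Let $M$ be a connected semi-Riemannian manifold with Levi-Civita connection $\nabla$, isometrically immersed in $\bar P$ by a smooth map $f$; tangent vectors of $M$ are identified with their images under $df$. Let $\alpha$ be the second fundamental form (the normal part of $\bar\nabla_XY$ for $X,Y$ tangent to $M$), let $A_\eta$ be the shape operator in the normal direction $\eta$, $\langle A_\eta X,Y\rangle=\langle\alpha(X,Y),\eta\rangle$, and let $\nabla^\perp$ be the normal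 connection (the normal part of $\bar\nabla_X\eta$ for normal fields $\eta$). Let $\pi:M\to I$ be the composition of $f$ with the projection $\bar P\to I$, let $T=\varepsilon\,\mathrm{grad}(\pi)$, and define $\xi$ along $f$ by $\partial_t=T+\xi$. Then $\xi$ is normal to $M$ and, for every $x\in M$ and every $X\in T_xM$, with $a$ and $a'$ evaluated at $\pi(x)$: 1. $\bar\nabla_X\partial_t=\frac{a'}{a}\bigl(X-\varepsilon\langle X,T\rangle\partial_t\bigr)$; 2. $\nabla_XT=\frac{a'}{a}\bigl(X-\varepsilon\langle X,T\rangle T\bigr)+A_\xi X$; 3. $\nabla^\perp_X\xi=-\frac{\varepsilon a'}{a}\langle X,T\rangle\,\xi-\alpha(X,T)$. -/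

import Mathlib

open Bundle Manifold FiberBundle
open scoped ContDiff Topology

noncomputable section

section General

variable {E : Type*} [NormedAddCommGroup E] [NormedSpace ℝ E]
  {H : Type*} [TopologicalSpace H] {I : ModelWithCorners ℝ E H}
  {M : Type*} [TopologicalSpace M] [ChartedSpace H M]
  {F : Type*} [NormedAddCommGroup F] [NormedSpace ℝ F]
  {G : Type*} [TopologicalSpace G] {J : ModelWithCorners ℝ F G}
  {P : Type*} [TopologicalSpace P] [ChartedSpace G P]

/-- A smooth semi-Riemannian metric on `M`: a smooth symmetric nondegenerate (0,2)-tensor field,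
of arbitrary signature. Its index is locally constant, hence constant if `M` is connected. -/
structure SemiRiemannianMetric (I : ModelWithCorners ℝ E H)
    (M : Type*) [TopologicalSpace M] [ChartedSpace H M] [IsManifold I ∞ M] where
  val (x : M) : TangentSpace I x →L[ℝ] TangentSpace I x →L[ℝ] ℝ
  symm (x : M) (v w : TangentSpace I x) : val x v w = val x w v
  nondegenerate (x : M) (v : TangentSpace I x) : (∀ w, val x v w = 0) → v = 0
  contMDiff : ContMDiff I (I.prod 𝓘(ℝ, E →L[ℝ] E →L[ℝ] ℝ)) ∞
    (fun x ↦ TotalSpace.mk' (E →L[ℝ] E →L[ℝ] ℝ) x (val x))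

/-- `∇` is a Levi-Civita connection of `g`: torsion free and compatible with `g`.
In Mathlib, `nabla Y x (X x)` is `(∇_X Y)(x)`. -/
structure IsLeviCivita [IsManifold I ∞ M] (g : SemiRiemannianMetric I M)
    (nabla : CovariantDerivative I E (TangentSpace I : M → Type _)) : Prop where
  torsion_free : ∀ (X Y : Π x : M, TangentSpace I x) (x : M),
    MDiffAt (T% X) x → MDiffAt (T% Y) x →
    nabla Y x (X x) - nabla X x (Y x) = VectorField.mlieBracket I X Y x
  compatible : ∀ (Y Z : Π x : M, TangentSpace I x) (x : M) (v : TangentSpace I x),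
    MDiffAt (T% Y) x → MDiffAt (T% Z) x →
    mvfderiv I (fun y ↦ g.val y (Y y) (Z y)) x v
      = g.val x (nabla Y x v) (Z x) + g.val x (Y x) (nabla Z x v)

section Sharp
variable [IsManifold I ∞ M]
namespace SemiRiemannianMetric

theorem eq_of_val_eq (g : SemiRiemannianMetric I M) {x : M} {v v' : TangentSpace I x}
    (h : ∀ w, g.val x v w = g.val x v' w) : v = v' := by
  rw [← sub_eq_zero]
  exact g.nondegenerate x _ fun w ↦ by simp [h w]

variable [FiniteDimensional ℝ E]

theorem exists_unique_dual (g : SemiRiemannianMetric I M) (x : M) (φ : TangentSpace I x →ₗ[ℝ] ℝ) :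
    ∃! v, ∀ w, g.val x v w = φ w := by
  have : FiniteDimensional ℝ (TangentSpace I x) := inferInstanceAs (FiniteDimensional ℝ E)
  let B : TangentSpace I x →ₗ[ℝ] Module.Dual ℝ (TangentSpace I x) :=
    { toFun := fun v ↦ (g.val x v).toLinearMap
      map_add' := by intro v w; ext; simp
      map_smul' := by intro v w; ext; simp }
  have hB : Function.Injective B := by
    rw [← LinearMap.ker_eq_bot, LinearMap.ker_eq_bot']
    intro v hv
    exact g.nondegenerate x v fun w ↦ LinearMap.congr_fun hv w
  have hB2 : Function.Surjective B :=
    (LinearMap.injective_iff_surjective_of_finrank_eq_finrank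
      (Subspace.dual_finrank_eq).symm).1 hB
  obtain ⟨v, hv⟩ := hB2 φ
  refine ⟨v, fun w ↦ by rw [← hv]; rfl, fun v' hv' ↦ hB ?_⟩
  rw [hv]; ext w; exact hv' w

/-- The vector metrically equivalent to a covector: `⟨sharp φ, w⟩ = φ w` for all `w`. -/
def sharp (g : SemiRiemannianMetric I M) (x : M) (φ : TangentSpace I x →ₗ[ℝ] ℝ) :
    TangentSpace I x := (g.exists_unique_dual x φ).choose

theorem val_sharp (g : SemiRiemannianMetric I M) (x : M) (φ : TangentSpace I x →ₗ[ℝ] ℝ)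
    (w : TangentSpace I x) : g.val x (g.sharp x φ) w = φ w :=
  (g.exists_unique_dual x φ).choose_spec.1 w

/-- The gradient of a function: `⟨grad h, w⟩ = dh(w)`. -/
def grad (g : SemiRiemannianMetric I M) (h : M → ℝ) (x : M) : TangentSpace I x :=
  g.sharp x (mvfderiv I h x).toLinearMap

end SemiRiemannianMetric
end Sharp

section Along

theorem mvfderiv_congr {h h' : M → F} {x : M} (hh : h =ᶠ[𝓝 x] h') :
    mvfderiv I h x = mvfderiv I h' x := by
  ext v
  change (mfderiv I 𝓘(ℝ, F) h x v : F) = (mfderiv I 𝓘(ℝ, F) h' x v : F)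
  rw [hh.mfderiv_eq]
  rfl


section
variable [IsManifold J 1 P]

/-- The local extension of a tangent vector `v ∈ T_x P` to a vector field which is constant in the
trivialization of `TP` around `x`. -/
def localExtension {x : P} (v : TangentSpace J x) (y : P) : TangentSpace J y :=
  (trivializationAt F (TangentSpace J) x).symmL ℝ y
    ((trivializationAt F (TangentSpace J) x).continuousLinearMapAt ℝ x v)

theorem localExtension_add {x : P} (v w : TangentSpace J x) :
    localExtension (v + w) = localExtension v + localExtension w := by
  funext y; simp [localExtension]

theorem localExtension_smul {x : P} (c : ℝ) (v : TangentSpace J x) :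
    localExtension (c • v) = c • localExtension v := by
  funext y; simp [localExtension]

theorem localExtension_self {x : P} (v : TangentSpace J x) : localExtension v x = v :=
  (trivializationAt F (TangentSpace J) x).symmL_continuousLinearMapAt
    (FiberBundle.mem_baseSet_trivializationAt' x) v

theorem localExtension_reading {x : P} (v : TangentSpace J x) {y : P}
    (hy : y ∈ (trivializationAt F (TangentSpace J) x).baseSet) :
    (trivializationAt F (TangentSpace J) x (TotalSpace.mk' F y (localExtension v y))).2
      = (trivializationAt F (TangentSpace J) x).continuousLinearMapAt ℝ x v := by
  have h := (trivializationAt F (TangentSpace J) x).continuousLinearMapAt_symmL (R := ℝ) hy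
    ((trivializationAt F (TangentSpace J) x).continuousLinearMapAt ℝ x v)
  rw [Trivialization.continuousLinearMapAt_apply, Trivialization.linearMapAt_apply,
    if_pos hy] at h
  exact h

theorem mdiffAt_localExtension {x : P} (v : TangentSpace J x) :
    MDiffAt (T% (localExtension v)) x := by
  refine (mdifferentiableAt_section ..).2 ?_
  have h : (fun y ↦ (trivializationAt F (TangentSpace J) x
      (TotalSpace.mk' F y (localExtension v y))).2) =ᶠ[𝓝 x] fun _ ↦
        (trivializationAt F (TangentSpace J) x).continuousLinearMapAt ℝ x v :=
    Filter.eventually_of_mem ((trivializationAt F (TangentSpace J) x).open_baseSet.mem_nhds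
      (FiberBundle.mem_baseSet_trivializationAt' x)) fun y hy ↦ localExtension_reading v hy
  exact mdifferentiableAt_const.congr_of_eventuallyEq h

end

variable [IsManifold J ∞ P]

/-- The covariant derivative of a vector field `σ` along `f : M → P`
(the connection induced on `f^* TP`): in the local trivialization of `TP` around `f x`, with local
frame `(e_i)` and `σ = ∑ σ^i (e_i ∘ f)`, it is
`∇_X σ = ∑ dσ^i(X) e_i + ∑ σ^i ∇_{df X} e_i` at `x`. -/
def covAlong (nabla : CovariantDerivative J F (TangentSpace J : P → Type _)) (f : M → P)
    (σ : Π x : M, TangentSpace J (f x)) (x : M) : TangentSpace I x →L[ℝ] TangentSpace J (f x) :=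
  ((trivializationAt F (TangentSpace J) (f x)).symmL ℝ (f x)) ∘L
      mvfderiv I (fun y ↦ (trivializationAt F (TangentSpace J) (f x)
        (TotalSpace.mk' F (f y) (σ y))).2) x
    + (nabla (localExtension (σ x)) (f x)) ∘L mfderiv I J f x


theorem mdiffAt_reading {f : M → P} {σ : Π x : M, TangentSpace J (f x)} {x : M}
    (h : MDifferentiableAt I J.tangent (fun y ↦ TotalSpace.mk' F (f y) (σ y)) x) :
    MDifferentiableAt I 𝓘(ℝ, F) (fun y ↦ (trivializationAt F (TangentSpace J) (f x)
        (TotalSpace.mk' F (f y) (σ y))).2) x :=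
  ((mdifferentiableAt_totalSpace _ _).1 h).2

theorem covAlong_add (nabla : CovariantDerivative J F (TangentSpace J : P → Type _)) {f : M → P}
    {σ τ : Π x : M, TangentSpace J (f x)} {x : M}
    (hσ : MDifferentiableAt I J.tangent (fun y ↦ TotalSpace.mk' F (f y) (σ y)) x)
    (hτ : MDifferentiableAt I J.tangent (fun y ↦ TotalSpace.mk' F (f y) (τ y)) x) :
    covAlong (I := I) nabla f (σ + τ) x = covAlong nabla f σ x + covAlong nabla f τ x := by
  have hf : ContinuousAt f x := ((mdifferentiableAt_totalSpace _ _).1 hσ).1.continuousAt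
  have h : (fun y ↦ (trivializationAt F (TangentSpace J) (f x)
        (TotalSpace.mk' F (f y) ((σ + τ) y))).2) =ᶠ[𝓝 x]
      (fun y ↦ (trivializationAt F (TangentSpace J) (f x) (TotalSpace.mk' F (f y) (σ y))).2) +
      (fun y ↦ (trivializationAt F (TangentSpace J) (f x) (TotalSpace.mk' F (f y) (τ y))).2) := by
    filter_upwards [hf.preimage_mem_nhds
      ((trivializationAt F (TangentSpace J) (f x)).open_baseSet.mem_nhds
        (FiberBundle.mem_baseSet_trivializationAt' (f x)))] with y hy
    exact ((trivializationAt F (TangentSpace J) (f x)).linear ℝ hy).map_add (σ y) (τ y)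
  simp only [covAlong]
  rw [mvfderiv_congr h, mvfderiv_add (mdiffAt_reading hσ) (mdiffAt_reading hτ),
    Pi.add_apply, localExtension_add,
    nabla.isCovariantDerivativeOn.add (mdiffAt_localExtension _) (mdiffAt_localExtension _)]
  ext X
  simp
  abel

theorem covAlong_const_smul (nabla : CovariantDerivative J F (TangentSpace J : P → Type _))
    {f : M → P} {σ : Π x : M, TangentSpace J (f x)} {x : M} (c : ℝ)
    (hσ : MDifferentiableAt I J.tangent (fun y ↦ TotalSpace.mk' F (f y) (σ y)) x) :
    covAlong (I := I) nabla f (c • σ) x = c • covAlong nabla f σ x := by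
  have hf : ContinuousAt f x := ((mdifferentiableAt_totalSpace _ _).1 hσ).1.continuousAt
  have h : (fun y ↦ (trivializationAt F (TangentSpace J) (f x)
        (TotalSpace.mk' F (f y) ((c • σ) y))).2) =ᶠ[𝓝 x]
      (fun _ : M ↦ c) • (fun y ↦ (trivializationAt F (TangentSpace J) (f x)
        (TotalSpace.mk' F (f y) (σ y))).2) := by
    filter_upwards [hf.preimage_mem_nhds
      ((trivializationAt F (TangentSpace J) (f x)).open_baseSet.mem_nhds
        (FiberBundle.mem_baseSet_trivializationAt' (f x)))] with y hy
    exact ((trivializationAt F (TangentSpace J) (f x)).linear ℝ hy).map_smul c (σ y)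
  simp only [covAlong]
  rw [mvfderiv_congr h, mvfderiv_smul (a := fun _ : M ↦ c) mdifferentiableAt_const (mdiffAt_reading hσ),
    mvfderiv_const,
    Pi.smul_apply, localExtension_smul,
    nabla.isCovariantDerivativeOn.smul_const _ (mdiffAt_localExtension _)]
  ext X
  simp

/-- For the restriction to `f` of a vector field on `P`, the derivative along `f` is the ambient
one. -/
theorem covAlong_comp [FiniteDimensional ℝ F]
    (nabla : CovariantDerivative J F (TangentSpace J : P → Type _)) {f : M → P}
    {Y : Π p : P, TangentSpace J p} {x : M} (hf : MDifferentiableAt I J f x)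
    (hY : MDiffAt (T% Y) (f x)) :
    covAlong (I := I) nabla f (fun y ↦ Y (f y)) x = (nabla Y (f x)) ∘L mfderiv I J f x := by
  let t := trivializationAt F (TangentSpace J) (f x)
  have hmem := t.open_baseSet.mem_nhds (FiberBundle.mem_baseSet_trivializationAt' (f x))
  let Φ : (Π p : P, TangentSpace J p) → (TangentSpace J (f x) →L[ℝ] TangentSpace J (f x)) :=
    fun Z ↦ nabla Z (f x) - (t.symmL ℝ (f x)) ∘L mvfderiv J (fun p ↦ (t (TotalSpace.mk' F p (Z p))).2) (f x)
  have hread {Z : Π p : P, TangentSpace J p} (hZ : MDiffAt (T% Z) (f x)) :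
      MDifferentiableAt J 𝓘(ℝ, F) (fun p ↦ (t (TotalSpace.mk' F p (Z p))).2) (f x) :=
    (mdifferentiableAt_section ..).1 hZ
  have hΦ : TensorialAt J F Φ (f x) := by
    refine ⟨fun {h Z} hh hZ ↦ ?_, fun {Z Z'} hZ hZ' ↦ ?_⟩
    · have e : (fun p ↦ (t (TotalSpace.mk' F p ((h • Z) p))).2) =ᶠ[𝓝 (f x)]
          h • (fun p ↦ (t (TotalSpace.mk' F p (Z p))).2) := by
        filter_upwards [hmem] with y hy
        exact (t.linear ℝ hy).map_smul (h y) (Z y)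
      simp only [Φ]
      rw [nabla.isCovariantDerivativeOn.leibniz hZ hh, mvfderiv_congr e,
        mvfderiv_smul hh (hread hZ)]
      have hs : t.symmL ℝ (f x) (t (TotalSpace.mk' F (f x) (Z (f x)))).2 = Z (f x) := by
        have hb := FiberBundle.mem_baseSet_trivializationAt' (F := F) (E := TangentSpace J) (f x)
        have h1 := t.symmL_continuousLinearMapAt (R := ℝ) hb (Z (f x))
        rwa [Trivialization.continuousLinearMapAt_apply, Trivialization.linearMapAt_apply,
          if_pos hb] at h1
      ext v
      simp [hs, smul_sub]
    · have e : (fun p ↦ (t (TotalSpace.mk' F p ((Z + Z') p))).2) =ᶠ[𝓝 (f x)]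
          (fun p ↦ (t (TotalSpace.mk' F p (Z p))).2) +
          (fun p ↦ (t (TotalSpace.mk' F p (Z' p))).2) := by
        filter_upwards [hmem] with y hy
        exact (t.linear ℝ hy).map_add (Z y) (Z' y)
      simp only [Φ]
      rw [nabla.isCovariantDerivativeOn.add hZ hZ', mvfderiv_congr e,
        mvfderiv_add (hread hZ) (hread hZ')]
      ext v
      simp
      abel
  have key := hΦ.pointwise hY (mdiffAt_localExtension (Y (f x))) (localExtension_self _).symm
  have e : (fun p ↦ (t (TotalSpace.mk' F p (localExtension (Y (f x)) p))).2) =ᶠ[𝓝 (f x)]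
      fun _ ↦ t.continuousLinearMapAt ℝ (f x) (Y (f x)) := by
    filter_upwards [hmem] with y hy
    exact localExtension_reading _ hy
  simp only [Φ] at key
  rw [mvfderiv_congr e, mvfderiv_const, ContinuousLinearMap.comp_zero, sub_zero] at key
  simp only [covAlong]
  rw [← key]
  have hc : mvfderiv I (fun y ↦ (t (TotalSpace.mk' F (f y) (Y (f y)))).2) x
      = (mvfderiv J (fun p ↦ (t (TotalSpace.mk' F p (Y p))).2) (f x)) ∘L mfderiv I J f x := by
    have h := mfderiv_comp x (hread hY) hf
    ext v
    exact congr($h v)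
  rw [hc, ContinuousLinearMap.sub_comp, ContinuousLinearMap.comp_assoc]
  abel

end Along

section Pullback

/-- The pullback `(v, w) ↦ B (D v) (D w)` of a bilinear form. -/
def pullbackForm {V W : Type*} [AddCommGroup V] [Module ℝ V] [TopologicalSpace V]
    [AddCommGroup W] [Module ℝ W] [TopologicalSpace W] (B : W →L[ℝ] W →L[ℝ] ℝ) (D : V →L[ℝ] W) : V →L[ℝ] V →L[ℝ] ℝ :=
  (D.precomp ℝ) ∘L B ∘L D

theorem pullbackForm_apply {V W : Type*} [AddCommGroup V] [Module ℝ V] [TopologicalSpace V]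
    [AddCommGroup W] [Module ℝ W] [TopologicalSpace W] (B : W →L[ℝ] W →L[ℝ] ℝ) (D : V →L[ℝ] W)
    (v w : V) : pullbackForm B D v w = B (D v) (D w) := rfl

variable [IsManifold I ∞ M] [IsManifold J ∞ P]

theorem linearMapAt_dual_apply {x y : P}
    (hy : y ∈ (trivializationAt F (TangentSpace J) x).baseSet) (φ : TangentSpace J y →L[ℝ] ℝ)
    (w : F) :
    (Trivialization.linearMapAt ℝ
      (trivializationAt (F →L[ℝ] ℝ) (fun p : P ↦ TangentSpace J p →L[ℝ] ℝ) x) y φ) w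
      = φ ((trivializationAt F (TangentSpace J) x).symmL ℝ y w) := by
  rw [Trivialization.linearMapAt_apply, if_pos ⟨hy, Set.mem_univ _⟩]
  simp [hom_trivializationAt_apply, ContinuousLinearMap.inCoordinates]

theorem contMDiff_pullback {g : Π p : P, TangentSpace J p →L[ℝ] TangentSpace J p →L[ℝ] ℝ}
    (hg : ContMDiff J (J.prod 𝓘(ℝ, F →L[ℝ] F →L[ℝ] ℝ)) ∞
      (fun x ↦ TotalSpace.mk' (F →L[ℝ] F →L[ℝ] ℝ) x (g x)))
    {f : M → P} (hf : ContMDiff I J ∞ f) :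
    ContMDiff I (I.prod 𝓘(ℝ, E →L[ℝ] E →L[ℝ] ℝ)) ∞
      (fun x ↦ TotalSpace.mk' (E →L[ℝ] E →L[ℝ] ℝ)
        (E := fun x : M ↦ TangentSpace I x →L[ℝ] TangentSpace I x →L[ℝ] ℝ) x
        (pullbackForm (g (f x)) (mfderiv I J f x))) := by
  intro x₀
  rw [contMDiffAt_section]
  have h1 := ((contMDiffAt_section _).1 (hg (f x₀))).comp x₀ hf.contMDiffAt
  have h2 := (hf x₀).mfderiv_const (m := ∞) (by simp)
  have h3 := (h2.clm_precomp (F₃ := ℝ)).clm_comp (h1.clm_comp h2)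
  refine h3.congr_of_eventuallyEq ?_
  filter_upwards [hf.continuous.continuousAt.preimage_mem_nhds
      ((trivializationAt F (TangentSpace J) (f x₀)).open_baseSet.mem_nhds
        (FiberBundle.mem_baseSet_trivializationAt' (f x₀))),
    (trivializationAt E (TangentSpace I) x₀).open_baseSet.mem_nhds
      (FiberBundle.mem_baseSet_trivializationAt' x₀)] with y hy hx
  ext v w
  simp [hom_trivializationAt_apply, ContinuousLinearMap.inCoordinates, pullbackForm, inTangentCoordinates]
  rw [linearMapAt_dual_apply hx, linearMapAt_dual_apply hy]
  have h4 (u : TangentSpace J (f y)) :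
      (trivializationAt F (TangentSpace J) (f x₀)).symmL ℝ (f y)
        ((trivializationAt F (TangentSpace J) (f x₀)).linearMapAt ℝ (f y) u) = u := by
    have := (trivializationAt F (TangentSpace J) (f x₀)).symmL_continuousLinearMapAt (R := ℝ) hy u
    simpa using this
  simp [h4]
end Pullback

section Submanifold
variable [IsManifold I ∞ M] [IsManifold J ∞ P]

/-- An isometric immersion `(M, g) → (P, gP)`. -/
structure IsometricImmersion (g : SemiRiemannianMetric I M) (gP : SemiRiemannianMetric J P) where
  toFun : M → P
  contMDiff : ContMDiff I J ∞ toFun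
  injective (x : M) : Function.Injective (mfderiv I J toFun x)
  isometric (x : M) (v w : TangentSpace I x) :
    gP.val (toFun x) (mfderiv I J toFun x v) (mfderiv I J toFun x w) = g.val x v w

namespace IsometricImmersion
variable {g : SemiRiemannianMetric I M} {gP : SemiRiemannianMetric J P}

/-- The vector field along `f` obtained by pushing forward a vector field of `M`. -/
def push (f : IsometricImmersion g gP) (Y : Π x : M, TangentSpace I x) (x : M) :
    TangentSpace J (f.toFun x) := mfderiv I J f.toFun x (Y x)

theorem mdiffAt_push (f : IsometricImmersion g gP) {Y : Π x : M, TangentSpace I x} {x : M}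
    (hY : MDiffAt (T% Y) x) :
    MDifferentiableAt I J.tangent (fun y ↦ TotalSpace.mk' F (f.toFun y) (f.push Y y)) x := by
  have h := (f.contMDiff.contMDiff_tangentMap (m := 1) (by norm_cast)).mdifferentiable one_ne_zero
  exact (h (TotalSpace.mk' E x (Y x))).comp x hY

/-- `w ∈ T_{f x} P` is normal to the immersion. -/
def IsNormal (f : IsometricImmersion g gP) (x : M) (w : TangentSpace J (f.toFun x)) : Prop :=
  ∀ v : TangentSpace I x, gP.val (f.toFun x) w (mfderiv I J f.toFun x v) = 0

variable [FiniteDimensional ℝ E]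

/-- The tangential part of `w ∈ T_{f x} P`, as a vector of `T_x M`:
`⟨tangential w, v⟩ = ⟨w, df v⟩` for all `v ∈ T_x M`. -/
def tangential (f : IsometricImmersion g gP) (x : M) :
    TangentSpace J (f.toFun x) →ₗ[ℝ] TangentSpace I x where
  toFun w := g.sharp x ((gP.val (f.toFun x) w) ∘L mfderiv I J f.toFun x).toLinearMap
  map_add' w w' := g.eq_of_val_eq fun v ↦ by simp [g.val_sharp]
  map_smul' c w := g.eq_of_val_eq fun v ↦ by simp [g.val_sharp]

/-- The normal part of `w ∈ T_{f x} P`, that is, its component in `(df T_x M)^⊥`. -/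
def normal (f : IsometricImmersion g gP) (x : M) :
    TangentSpace J (f.toFun x) →ₗ[ℝ] TangentSpace J (f.toFun x) :=
  LinearMap.id - (mfderiv I J f.toFun x).toLinearMap ∘ₗ f.tangential x

theorem normal_orthogonal (f : IsometricImmersion g gP) (x : M) (w : TangentSpace J (f.toFun x)) :
    f.IsNormal x (f.normal x w) := by
  intro v
  simp [normal, tangential, f.isometric, g.val_sharp]

/-- The second fundamental form `α(X, Y) = (∇̄_X Y)^⊥`, where `Y` is extended to a vector field
near `x`. -/
def secondFundamentalForm (f : IsometricImmersion g gP)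
    (nablaP : CovariantDerivative J F (TangentSpace J : P → Type _)) (x : M) :
    TangentSpace I x →ₗ[ℝ] TangentSpace I x →ₗ[ℝ] TangentSpace J (f.toFun x) :=
  LinearMap.mk₂ ℝ
    (fun X Y ↦ f.normal x (covAlong nablaP f.toFun (f.push (localExtension Y)) x X))
    (fun X X' Y ↦ by simp) (fun c X Y ↦ by simp)
    (fun X Y Y' ↦ by
      have h : f.push (localExtension (Y + Y')) = f.push (localExtension Y) + f.push (localExtension Y') := by
        funext y; simp [push, localExtension_add]
      rw [h, covAlong_add nablaP
        (f.mdiffAt_push (mdiffAt_localExtension _))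
        (f.mdiffAt_push (mdiffAt_localExtension _))]
      simp)
    (fun c X Y ↦ by
      have h : f.push (localExtension (c • Y)) = c • f.push (localExtension Y) := by
        funext y; simp [push, localExtension_smul]
      rw [h, covAlong_const_smul nablaP c
        (f.mdiffAt_push (mdiffAt_localExtension _))]
      simp)

/-- The shape operator: `⟨A_η X, Y⟩ = ⟨α(X, Y), η⟩` for all `Y ∈ T_x M`. -/
def shapeOperator (f : IsometricImmersion g gP)
    (nablaP : CovariantDerivative J F (TangentSpace J : P → Type _)) (x : M)
    (η : TangentSpace J (f.toFun x)) (X : TangentSpace I x) : TangentSpace I x :=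
  g.sharp x ((gP.val (f.toFun x) η).toLinearMap ∘ₗ f.secondFundamentalForm nablaP x X)

/-- The normal connection `∇^⊥_X η = (∇̄_X η)^⊥`, for a section `η` of the normal bundle. -/
def normalConnection (f : IsometricImmersion g gP)
    (nablaP : CovariantDerivative J F (TangentSpace J : P → Type _))
    (η : Π x : M, TangentSpace J (f.toFun x)) (x : M) (X : TangentSpace I x) :
    TangentSpace J (f.toFun x) :=
  f.normal x (covAlong nablaP f.toFun η x X)

end IsometricImmersion
end Submanifold
end General
/-- The standard scalar product of index `ν` on `ℝ^m`: the last `ν` coordinates count negatively. -/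
def pseudoEuclidean (m ν : ℕ) :
    EuclideanSpace ℝ (Fin m) →L[ℝ] EuclideanSpace ℝ (Fin m) →L[ℝ] ℝ :=
  LinearMap.toContinuousBilinearMap (LinearMap.mk₂ ℝ
    (fun x y ↦ ∑ i : Fin m, (if i.val + ν < m then (1 : ℝ) else -1) * (x i * y i))
    (fun x x' y ↦ by simp [add_mul, mul_add, Finset.sum_add_distrib])
    (fun r x y ↦ by simp only [PiLp.smul_apply, smul_eq_mul, Finset.mul_sum]; congr! 1; ring)
    (fun x y y' ↦ by simp [mul_add, Finset.sum_add_distrib])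
    (fun r x y ↦ by simp only [PiLp.smul_apply, smul_eq_mul, Finset.mul_sum]; congr! 1; ring))

theorem pseudoEuclidean_apply (m ν : ℕ) (x y : EuclideanSpace ℝ (Fin m)) :
    pseudoEuclidean m ν x y
      = ∑ i : Fin m, (if i.val + ν < m then (1 : ℝ) else -1) * (x i * y i) := rfl

theorem pseudoEuclidean_symm (m ν : ℕ) (x y : EuclideanSpace ℝ (Fin m)) :
    pseudoEuclidean m ν x y = pseudoEuclidean m ν y x := by
  simp [pseudoEuclidean_apply, mul_comm]

theorem pseudoEuclidean_nondegenerate (m ν : ℕ) (x : EuclideanSpace ℝ (Fin m))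
    (h : ∀ y, pseudoEuclidean m ν x y = 0) : x = 0 := by
  ext i
  have := h (EuclideanSpace.single i 1)
  rw [pseudoEuclidean_apply, Finset.sum_eq_single i (by intro j _ hj; simp [hj]) (by simp)] at this
  split_ifs at this <;> simpa using this

/-- The scalar product `g₀` of the flat space `𝔼^{N+1}_l` containing the space form of dimension
`N`, index `l` and curvature `c = ±1`: its index is `l` if `c = 1` and `l + 1` if `c = -1`. -/
def flatForm (N l : ℕ) (c : ℤˣ) :
    EuclideanSpace ℝ (Fin (N + 1)) →L[ℝ] EuclideanSpace ℝ (Fin (N + 1)) →L[ℝ] ℝ :=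
  pseudoEuclidean (N + 1) (if c = 1 then l else l + 1)

/-- The central quadric `{p ∈ 𝔼^{N+1}_l ; g₀(p, p) = c}`. -/
@[ext]
structure Quadric (N l : ℕ) (c : ℤˣ) where
  val : EuclideanSpace ℝ (Fin (N + 1))
  property : flatForm N l c val val = ((c : ℤ) : ℝ)

namespace Quadric
variable {N l : ℕ} {c : ℤˣ}

instance : TopologicalSpace (Quadric N l c) :=
  TopologicalSpace.induced Quadric.val inferInstance

theorem isInducing_val : Topology.IsInducing (Quadric.val : Quadric N l c → _) := ⟨rfl⟩

theorem continuous_val : Continuous (Quadric.val : Quadric N l c → _) := isInducing_val.continuous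

theorem coe_mul_self (c : ℤˣ) : ((c : ℤ) : ℝ) * ((c : ℤ) : ℝ) = 1 := by
  rcases Int.units_eq_one_or c with rfl | rfl <;> simp

theorem form_symm (x y : EuclideanSpace ℝ (Fin (N + 1))) :
    flatForm N l c x y = flatForm N l c y x := pseudoEuclidean_symm _ _ x y

/-- The linear hyperplane `p^⊥` of `𝔼^{N+1}_l`. -/
def orth (p : Quadric N l c) : Submodule ℝ (EuclideanSpace ℝ (Fin (N + 1))) :=
  LinearMap.ker (flatForm N l c p.val).toLinearMap

theorem mem_orth {p : Quadric N l c} {w : EuclideanSpace ℝ (Fin (N + 1))} :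
    w ∈ orth p ↔ flatForm N l c p.val w = 0 := Iff.rfl

theorem finrank_orth (p : Quadric N l c) : Module.finrank ℝ (orth p) = N := by
  have h : (flatForm N l c p.val).toLinearMap ≠ 0 := by
    intro h
    have h1 : flatForm N l c p.val p.val = 0 := LinearMap.congr_fun h p.val
    rw [p.property] at h1
    have := coe_mul_self c
    rw [h1] at this
    simp at this
  have := Module.Dual.finrank_ker_add_one_of_ne_zero (f := (flatForm N l c p.val).toLinearMap) h
  rw [finrank_euclideanSpace_fin] at this
  exact Nat.add_right_cancel this

/-- Linear coordinates on `p^⊥`. -/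
def orthEquiv (p : Quadric N l c) : orth p ≃L[ℝ] EuclideanSpace ℝ (Fin N) :=
  ContinuousLinearEquiv.ofFinrankEq (by rw [finrank_orth, finrank_euclideanSpace_fin])

/-- The `g₀`-orthogonal projection onto `p^⊥`. -/
def orthProj (p : Quadric N l c) : EuclideanSpace ℝ (Fin (N + 1)) →L[ℝ] orth p :=
  (ContinuousLinearMap.id ℝ _ - (((c : ℤ) : ℝ) • flatForm N l c p.val).smulRight p.val).codRestrict
    (orth p) (fun x ↦ by
      rw [mem_orth]
      simp only [_root_.sub_apply, ContinuousLinearMap.id_apply,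
        ContinuousLinearMap.smulRight_apply, _root_.smul_apply, map_sub, map_smul,
        smul_eq_mul, p.property]
      linear_combination (-(flatForm N l c p.val x)) * coe_mul_self c)

theorem coe_orthProj (p : Quadric N l c) (x : EuclideanSpace ℝ (Fin (N + 1))) :
    (orthProj p x : EuclideanSpace ℝ (Fin (N + 1)))
      = x - (((c : ℤ) : ℝ) * flatForm N l c p.val x) • p.val := rfl

/-- `1 - c g₀(w, w)` for `w ∈ p^⊥` with linear coordinates `v`. -/
def height (p : Quadric N l c) (v : EuclideanSpace ℝ (Fin N)) : ℝ :=
  1 - ((c : ℤ) : ℝ) * flatForm N l c ((orthEquiv p).symm v : EuclideanSpace ℝ (Fin (N + 1)))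
    ((orthEquiv p).symm v : EuclideanSpace ℝ (Fin (N + 1)))

/-- The graph parametrization `w ↦ √(1 - c g₀(w, w)) p + w` of the quadric over `p^⊥`. -/
def param (p : Quadric N l c) (v : EuclideanSpace ℝ (Fin N)) : EuclideanSpace ℝ (Fin (N + 1)) :=
  √(height p v) • p.val + ((orthEquiv p).symm v : EuclideanSpace ℝ (Fin (N + 1)))

theorem form_param (p : Quadric N l c) (v : EuclideanSpace ℝ (Fin N)) :
    flatForm N l c p.val (param p v) = √(height p v) * ((c : ℤ) : ℝ) := by
  have h : flatForm N l c p.val ((orthEquiv p).symm v : EuclideanSpace ℝ (Fin (N + 1))) = 0 :=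
    ((orthEquiv p).symm v).2
  simp [param, h, p.property]

theorem param_mem (p : Quadric N l c) {v : EuclideanSpace ℝ (Fin N)} (hv : 0 ≤ height p v) :
    flatForm N l c (param p v) (param p v) = ((c : ℤ) : ℝ) := by
  have h : flatForm N l c p.val ((orthEquiv p).symm v : EuclideanSpace ℝ (Fin (N + 1))) = 0 :=
    ((orthEquiv p).symm v).2
  have h1 : flatForm N l c (param p v) (param p v) = √(height p v) * √(height p v) * ((c : ℤ) : ℝ)
      + flatForm N l c ((orthEquiv p).symm v : EuclideanSpace ℝ (Fin (N + 1)))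
        ((orthEquiv p).symm v : EuclideanSpace ℝ (Fin (N + 1))) := by
    simp only [param, map_add, map_smul, _root_.add_apply,
      _root_.smul_apply, smul_eq_mul, h, p.property,
      form_symm ((orthEquiv p).symm v : EuclideanSpace ℝ (Fin (N + 1))) p.val]
    ring
  rw [h1, Real.mul_self_sqrt hv, height]
  linear_combination (-flatForm N l c ((orthEquiv p).symm v : EuclideanSpace ℝ (Fin (N + 1)))
        ((orthEquiv p).symm v : EuclideanSpace ℝ (Fin (N + 1)))) * coe_mul_self c

theorem orthProj_param (p : Quadric N l c) (v : EuclideanSpace ℝ (Fin N)) :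
    orthProj p (param p v) = (orthEquiv p).symm v := by
  ext1
  rw [coe_orthProj, form_param, param]
  have : ((c : ℤ) : ℝ) * (√(height p v) * ((c : ℤ) : ℝ)) = √(height p v) := by
    linear_combination √(height p v) * coe_mul_self c
  rw [this]; abel

theorem height_orthProj (p q : Quadric N l c) :
    height p (orthEquiv p (orthProj p q.val)) = (((c : ℤ) : ℝ) * flatForm N l c p.val q.val) ^ 2 := by
  simp only [height, ContinuousLinearEquiv.symm_apply_apply, coe_orthProj, map_sub, map_smul,
    _root_.sub_apply, _root_.smul_apply, smul_eq_mul, p.property, q.property,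
    form_symm q.val p.val]
  have := coe_mul_self c
  set C := ((c : ℤ) : ℝ)
  set s := flatForm N l c p.val q.val
  linear_combination (-1 - C * C * s ^ 2) * this

theorem param_orthProj (p q : Quadric N l c) (h : 0 < ((c : ℤ) : ℝ) * flatForm N l c p.val q.val) :
    param p (orthEquiv p (orthProj p q.val)) = q.val := by
  rw [param, height_orthProj, Real.sqrt_sq h.le, ContinuousLinearEquiv.symm_apply_apply,
    coe_orthProj]
  abel

theorem continuous_height (p : Quadric N l c) : Continuous (height p) := by
  unfold height; fun_prop

theorem continuous_param (p : Quadric N l c) : Continuous (param p) := by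
  have := continuous_height p
  unfold param; fun_prop

open Classical in
/-- The graph parametrization as a map into the quadric, with a junk value outside its domain. -/
def lift (p : Quadric N l c) (v : EuclideanSpace ℝ (Fin N)) : Quadric N l c :=
  if h : 0 < height p v then ⟨param p v, param_mem p h.le⟩ else p

theorem lift_val (p : Quadric N l c) {v : EuclideanSpace ℝ (Fin N)} (hv : 0 < height p v) :
    (lift p v).val = param p v := by
  rw [lift, dif_pos hv]

/-- The chart of the quadric around `p`: orthogonal projection of the open part
`{q ; c g₀(p, q) > 0}` to `p^⊥`. -/
def chart (p : Quadric N l c) :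
    OpenPartialHomeomorph (Quadric N l c) (EuclideanSpace ℝ (Fin N)) where
  toFun q := orthEquiv p (orthProj p q.val)
  invFun := lift p
  source := {q | 0 < ((c : ℤ) : ℝ) * flatForm N l c p.val q.val}
  target := {v | 0 < height p v}
  map_source' q hq := by
    simp only [Set.mem_ofPred_eq] at hq ⊢
    rw [height_orthProj]; positivity
  map_target' v hv := by
    simp only [Set.mem_ofPred_eq] at hv ⊢
    rw [lift_val p hv, form_param]
    have := Real.sqrt_pos.2 hv
    linarith [show ((c : ℤ) : ℝ) * (√(height p v) * ((c : ℤ) : ℝ)) = √(height p v) by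
      linear_combination √(height p v) * coe_mul_self c]
  left_inv' q hq := by
    have h : 0 < height p (orthEquiv p (orthProj p q.val)) := by
      rw [height_orthProj]; exact pow_pos hq 2
    exact Quadric.ext ((lift_val p h).trans (param_orthProj p q hq))
  right_inv' v hv := by
    simp only [lift_val p hv, orthProj_param, ContinuousLinearEquiv.apply_symm_apply]
  open_source := by
    have := continuous_val (N := N) (l := l) (c := c)
    exact isOpen_lt continuous_const (by fun_prop)
  open_target := isOpen_lt continuous_const (continuous_height p)
  continuousOn_toFun := by
    have := continuous_val (N := N) (l := l) (c := c)
    exact Continuous.continuousOn (by fun_prop)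
  continuousOn_invFun := by
    rw [isInducing_val.continuousOn_iff]
    exact (continuous_param p).continuousOn.congr fun v hv ↦ lift_val p hv

theorem mem_chart_source (p : Quadric N l c) : p ∈ (chart p).source := by
  show 0 < ((c : ℤ) : ℝ) * flatForm N l c p.val p.val
  rw [p.property, coe_mul_self]; exact one_pos

instance : ChartedSpace (EuclideanSpace ℝ (Fin N)) (Quadric N l c) where
  atlas := Set.range chart
  chartAt := chart
  mem_chart_source := mem_chart_source
  chart_mem_atlas p := ⟨p, rfl⟩

theorem contDiffOn_param (p : Quadric N l c) : ContDiffOn ℝ ∞ (param p) {v | 0 < height p v} := by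
  have h1 : ContDiff ℝ ∞ (fun v ↦ ((orthEquiv p).symm v : EuclideanSpace ℝ (Fin (N + 1)))) :=
    ((orth p).subtypeL ∘L (orthEquiv p).symm.toContinuousLinearMap).contDiff
  have h2 : ContDiff ℝ ∞ (height p) :=
    contDiff_const.sub (contDiff_const.mul
      (((flatForm N l c).contDiff.comp h1).clm_apply h1))
  exact ((h2.contDiffOn.sqrt fun v hv ↦ ne_of_gt hv).smul contDiffOn_const).add h1.contDiffOn

instance : IsManifold (𝓡 N) ∞ (Quadric N l c) := by
  refine isManifold_of_contDiffOn _ _ _ ?_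
  rintro _ _ ⟨p, rfl⟩ ⟨q, rfl⟩
  simp only [modelWithCornersSelf_coe, modelWithCornersSelf_coe_symm, Set.range_id,
    Set.inter_univ, Set.preimage_id, Function.id_comp, Function.comp_id]
  have h : ContDiffOn ℝ ∞ (fun v ↦ orthEquiv q (orthProj q (param p v))) {v | 0 < height p v} :=
    ((orthEquiv q).toContinuousLinearMap ∘L (orthProj q)).contDiff.comp_contDiffOn
      (contDiffOn_param p)
  refine (h.mono fun v hv ↦ ?_).congr fun v hv ↦ ?_
  · exact hv.1
  · show orthEquiv q (orthProj q (lift p v).val) = _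
    rw [lift_val p hv.1]

/-- The inclusion of the quadric into the ambient vector space is smooth. -/
theorem contMDiff_val : ContMDiff (𝓡 N) 𝓘(ℝ, EuclideanSpace ℝ (Fin (N + 1))) ∞
    (Quadric.val : Quadric N l c → EuclideanSpace ℝ (Fin (N + 1))) := by
  intro p
  rw [contMDiffAt_iff]
  refine ⟨continuous_val.continuousAt, ?_⟩
  have hp : (chart p) p ∈ {v | 0 < height p v} := (chart p).map_source (mem_chart_source p)
  have h := ((contDiffOn_param p).congr fun v hv ↦ lift_val p hv).contDiffAt
    ((isOpen_lt continuous_const (continuous_height p)).mem_nhds hp)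
  simpa using! h.contDiffWithinAt

end Quadric

section Warped

theorem hasMFDerivAt_subtype_val {E : Type*} [NormedAddCommGroup E] [NormedSpace ℝ E]
    {H : Type*} [TopologicalSpace H] {I : ModelWithCorners ℝ E H}
    {M : Type*} [TopologicalSpace M] [ChartedSpace H M] {U : TopologicalSpace.Opens M} (x : U) :
    HasMFDerivAt I I (Subtype.val : U → M) x (ContinuousLinearMap.id ℝ E) := by
  refine ⟨continuous_subtype_val.continuousAt, ?_⟩
  refine (hasFDerivWithinAt_id (𝕜 := ℝ) _ _).congr_of_eventuallyEq ?_ ?_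
  · have h := extChartAt_target_mem_nhdsWithin (I := I) x
    filter_upwards [h] with y hy
    have := (extChartAt I x).right_inv hy
    exact this
  · simp [writtenInExtChartAt]
    rfl

theorem contMDiff_constForm {V : Type*} [NormedAddCommGroup V] [NormedSpace ℝ V]
    (B : V →L[ℝ] V →L[ℝ] ℝ) :
    ContMDiff 𝓘(ℝ, V) (𝓘(ℝ, V).prod 𝓘(ℝ, V →L[ℝ] V →L[ℝ] ℝ)) ∞
      (fun x : V ↦ TotalSpace.mk' (V →L[ℝ] V →L[ℝ] ℝ)
        (E := fun x : V ↦ TangentSpace 𝓘(ℝ, V) x →L[ℝ] TangentSpace 𝓘(ℝ, V) x →L[ℝ] ℝ) x B) := by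
  intro x
  refine (contMDiffAt_section (F := V →L[ℝ] V →L[ℝ] ℝ)
    (E := fun x : V ↦ TangentSpace 𝓘(ℝ, V) x →L[ℝ] TangentSpace 𝓘(ℝ, V) x →L[ℝ] ℝ) (s := fun _ ↦ B)
    x).2 ?_
  convert! contMDiffAt_const (c := B)
  ext v w
  erw [hom_trivializationAt_apply]
  simp [ContinuousLinearMap.inCoordinates]
  erw [linearMapAt_dual_apply (Set.mem_univ _)]
  simp
  rfl

variable {F : Type*} [NormedAddCommGroup F] [NormedSpace ℝ F]
  {G : Type*} [TopologicalSpace G] {J : ModelWithCorners ℝ F G}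
  {P : Type*} [TopologicalSpace P] [ChartedSpace G P] 

/-- The projection `(t, p) ↦ t` of `S × P` to the coordinate of the open set `S ⊆ ℝ`. -/
def timeCoord (S : TopologicalSpace.Opens ℝ) (q : S × P) : ℝ := (q.1 : ℝ)

/-- The coordinate vector field `∂_t` on `S × P`. -/
def partialT (S : TopologicalSpace.Opens ℝ) (q : S × P) : TangentSpace (𝓘(ℝ, ℝ).prod J) q :=
  ((1 : ℝ), (0 : F))

theorem hasMFDerivAt_timeCoord (S : TopologicalSpace.Opens ℝ) (q : S × P) :
    HasMFDerivAt (𝓘(ℝ, ℝ).prod J) 𝓘(ℝ, ℝ) (timeCoord S : S × P → ℝ) q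
      (ContinuousLinearMap.fst ℝ ℝ F) :=
  (hasMFDerivAt_subtype_val (I := 𝓘(ℝ, ℝ)) q.1).comp q (hasMFDerivAt_fst q)

theorem mvfderiv_timeCoord (S : TopologicalSpace.Opens ℝ) (q : S × P)
    (v : TangentSpace (𝓘(ℝ, ℝ).prod J) q) :
    mvfderiv (𝓘(ℝ, ℝ).prod J) (timeCoord S : S × P → ℝ) q v = (v : ℝ × F).1 := 
  congr($((hasMFDerivAt_timeCoord (J := J) S q).mfderiv) v)

theorem contMDiff_timeCoord (S : TopologicalSpace.Opens ℝ) :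
    ContMDiff (𝓘(ℝ, ℝ).prod J) 𝓘(ℝ, ℝ) ∞ (timeCoord S : S × P → ℝ) :=
  contMDiff_subtype_val.comp contMDiff_fst

variable [IsManifold J ∞ P]

/-- The warped product metric `ε dt² + a(t)² g_P` on `S × P`, written `ε S ×_a P`, for an open
`S ⊆ ℝ` and a smooth positive `a` on `S`. -/
def warpedMetric (ε : ℤˣ) (S : TopologicalSpace.Opens ℝ) (a : ℝ → ℝ)
    (ha : ContDiffOn ℝ ∞ a S) (hpos : ∀ t ∈ S, 0 < a t) (gP : SemiRiemannianMetric J P) :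
    SemiRiemannianMetric (𝓘(ℝ, ℝ).prod J) (S × P) where
  val q := ((ε : ℤ) : ℝ) • pullbackForm (ContinuousLinearMap.mul ℝ ℝ)
      (mvfderiv (𝓘(ℝ, ℝ).prod J) (timeCoord S : S × P → ℝ) q)
    + (a (timeCoord S q)) ^ 2 • pullbackForm (gP.val q.2)
      (mfderiv (𝓘(ℝ, ℝ).prod J) J (Prod.snd : S × P → P) q)
  symm q v w := by
    simp only [_root_.add_apply, _root_.smul_apply, pullbackForm_apply, ContinuousLinearMap.mul_apply',
      mul_comm (mvfderiv (𝓘(ℝ, ℝ).prod J) (timeCoord S : S × P → ℝ) q v)]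
    rw [gP.symm]
  nondegenerate q v h := by
    simp only [_root_.add_apply, _root_.smul_apply, pullbackForm_apply, ContinuousLinearMap.mul_apply',
      mvfderiv_timeCoord, mfderiv_snd, smul_eq_mul] at h
    have hε : ((ε : ℤ) : ℝ) ≠ 0 := by
      rcases Int.units_eq_one_or ε with rfl | rfl <;> simp
    have ha0 : a (timeCoord S q) ≠ 0 := ne_of_gt (hpos _ q.1.2)
    refine Prod.ext ?_ (gP.nondegenerate q.2 _ fun w ↦ ?_)
    · have h1 := h ((1 : ℝ), (0 : F))
      have h2 : gP.val q.2 (v : ℝ × F).2 (0 : F) = 0 := map_zero _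
      change _ * ((v : ℝ × F).1 * 1) + _ * gP.val q.2 (v : ℝ × F).2 (0 : F) = 0 at h1
      rw [h2] at h1
      have h3 : (v : ℝ × F).1 = 0 := by simpa [hε] using h1
      exact h3
    · have h1 := h ((0 : ℝ), w)
      change _ * ((v : ℝ × F).1 * 0) + _ * gP.val q.2 (v : ℝ × F).2 w = 0 at h1
      simpa [ha0] using h1
  contMDiff := by
    have h1 := contMDiff_pullback (contMDiff_constForm (ContinuousLinearMap.mul ℝ ℝ))
      (contMDiff_timeCoord (P := P) (J := J) S)
    have h2 := contMDiff_pullback gP.contMDiff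
      (contMDiff_snd (I := 𝓘(ℝ, ℝ)) (J := J) (M := S) (N := P))
    have h3 : ContMDiff (𝓘(ℝ, ℝ).prod J) 𝓘(ℝ, ℝ) ∞ (fun q : S × P ↦ (a (timeCoord S q)) ^ 2) := by
      refine ContMDiff.pow (fun q ↦ ?_) 2
      exact ((ha.contDiffAt (S.isOpen.mem_nhds q.1.2)).contMDiffAt).comp q
        (contMDiff_timeCoord S q)
    exact (h1.const_smul_section (a := ((ε : ℤ) : ℝ))).add_section (h3.smul_section h2)

end Warped

section SpaceForm
variable {N l : ℕ} {c : ℤˣ}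

/-- The connected component of `p₀` in the quadric: the space form `𝕄^N_l(c)`. -/
def SpaceForm (p₀ : Quadric N l c) : TopologicalSpace.Opens (Quadric N l c) where
  carrier := connectedComponent p₀
  is_open' := by
    have : LocallyConnectedSpace (Quadric N l c) :=
      ChartedSpace.locallyConnectedSpace (EuclideanSpace ℝ (Fin N)) _
    exact isOpen_connectedComponent

/-- The inclusion `Ξ` of the space form into the flat space. -/
def SpaceForm.incl (p₀ : Quadric N l c) (q : SpaceForm p₀) : EuclideanSpace ℝ (Fin (N + 1)) :=
  q.1.val

theorem SpaceForm.contMDiff_incl (p₀ : Quadric N l c) :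
    ContMDiff (𝓡 N) 𝓘(ℝ, EuclideanSpace ℝ (Fin (N + 1))) ∞ (SpaceForm.incl p₀) :=
  Quadric.contMDiff_val.comp contMDiff_subtype_val

theorem Quadric.hasFDerivAt_param (p : Quadric N l c) :
    HasFDerivAt (Quadric.param p)
      ((Quadric.orth p).subtypeL ∘L (Quadric.orthEquiv p).symm.toContinuousLinearMap) 0 := by
  set A := (Quadric.orth p).subtypeL ∘L (Quadric.orthEquiv p).symm.toContinuousLinearMap with hA
  have h1 : HasFDerivAt (Quadric.height p)
      (0 : EuclideanSpace ℝ (Fin N) →L[ℝ] ℝ) 0 := by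
    have h := (((flatForm N l c).isBoundedBilinearMap.hasFDerivAt (A 0, A 0)).comp
      (0 : EuclideanSpace ℝ (Fin N)) (A.hasFDerivAt.prodMk A.hasFDerivAt)).const_mul ((c : ℤ) : ℝ)
      |>.const_sub 1
    refine h.congr_fderiv ?_
    ext v
    simp
  have h0 : Quadric.height p 0 = 1 := by simp [Quadric.height]
  have h2 := ((h1.sqrt (by rw [h0]; exact one_ne_zero)).smul_const p.val).add A.hasFDerivAt
  refine h2.congr_fderiv ?_
  ext v
  simp

theorem Quadric.hasMFDerivAt_val (p : Quadric N l c) :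
    HasMFDerivAt (𝓡 N) 𝓘(ℝ, EuclideanSpace ℝ (Fin (N + 1))) Quadric.val p
      ((Quadric.orth p).subtypeL ∘L (Quadric.orthEquiv p).symm.toContinuousLinearMap) := by
  refine ⟨Quadric.continuous_val.continuousAt, ?_⟩
  have h0 : (chartAt (EuclideanSpace ℝ (Fin N)) p) p = 0 := by
    change Quadric.orthEquiv p (Quadric.orthProj p p.val) = 0
    have : Quadric.orthProj p p.val = 0 := by
      ext1
      rw [Quadric.coe_orthProj, p.property, Quadric.coe_mul_self]
      simp
    rw [this, map_zero]
  have h : HasFDerivAt (Quadric.val ∘ Quadric.lift p)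
      ((Quadric.orth p).subtypeL ∘L (Quadric.orthEquiv p).symm.toContinuousLinearMap) 0 := by
    refine (Quadric.hasFDerivAt_param p).congr_of_eventuallyEq ?_
    have hm : {v | 0 < Quadric.height p v} ∈ 𝓝 (0 : EuclideanSpace ℝ (Fin N)) :=
      (isOpen_lt continuous_const (Quadric.continuous_height p)).mem_nhds
        (by simp [Quadric.height])
    filter_upwards [hm] with v hv
    exact Quadric.lift_val p hv
  have h' := h.hasFDerivWithinAt (s := Set.range (𝓡 N))
  rw [← h0] at h'
  exact h'

theorem SpaceForm.hasMFDerivAt_incl (p₀ : Quadric N l c) (q : SpaceForm p₀) :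
    HasMFDerivAt (𝓡 N) 𝓘(ℝ, EuclideanSpace ℝ (Fin (N + 1))) (SpaceForm.incl p₀) q
      ((Quadric.orth q.1).subtypeL ∘L (Quadric.orthEquiv q.1).symm.toContinuousLinearMap) :=
  (Quadric.hasMFDerivAt_val q.1).comp q (hasMFDerivAt_subtype_val q)

/-- The metric of the space form, induced by `g₀`. -/
def SpaceForm.metric (p₀ : Quadric N l c) : SemiRiemannianMetric (𝓡 N) (SpaceForm p₀) where
  val q := pullbackForm (flatForm N l c) (mvfderiv (𝓡 N) (SpaceForm.incl p₀) q)
  symm q v w := Quadric.form_symm _ _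
  nondegenerate q v h := by
    have hd (u : TangentSpace (𝓡 N) q) : mvfderiv (𝓡 N) (SpaceForm.incl p₀) q u
        = ((Quadric.orthEquiv q.1).symm u : EuclideanSpace ℝ (Fin (N + 1))) :=
      congr($((SpaceForm.hasMFDerivAt_incl p₀ q).mfderiv) u)
    have h1 (u : TangentSpace (𝓡 N) q) : flatForm N l c
        ((Quadric.orthEquiv q.1).symm v : EuclideanSpace ℝ (Fin (N + 1)))
        ((Quadric.orthEquiv q.1).symm u : EuclideanSpace ℝ (Fin (N + 1))) = 0 := by
      rw [← hd, ← hd]; exact h u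
    have h2 : ((Quadric.orthEquiv q.1).symm v : EuclideanSpace ℝ (Fin (N + 1))) = 0 := by
      refine pseudoEuclidean_nondegenerate (N + 1) (if c = 1 then l else l + 1) _ fun y ↦ ?_
      have h3 := h1 (Quadric.orthEquiv q.1 (Quadric.orthProj q.1 y))
      rw [ContinuousLinearEquiv.symm_apply_apply, Quadric.coe_orthProj, map_sub, map_smul,
        Quadric.form_symm _ q.1.val, Quadric.mem_orth.1 ((Quadric.orthEquiv q.1).symm v).2,
        smul_zero, sub_zero] at h3
      exact h3
    have h4 : (Quadric.orthEquiv q.1).symm v = 0 := Subtype.ext h2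
    exact (Quadric.orthEquiv q.1).symm.map_eq_zero_iff.1 h4
  contMDiff := contMDiff_pullback (contMDiff_constForm (flatForm N l c))
    (SpaceForm.contMDiff_incl p₀)

end SpaceForm

end

/-! ### Coordinate fields and their brackets. -/

section LocalExtension

variable {E : Type*} [NormedAddCommGroup E] [NormedSpace ℝ E]
  {H : Type*} [TopologicalSpace H] {I : ModelWithCorners ℝ E H}
  {M : Type*} [TopologicalSpace M] [ChartedSpace H M]
  {F : Type*} [NormedAddCommGroup F] [NormedSpace ℝ F]
  {G : Type*} [TopologicalSpace G] {J : ModelWithCorners ℝ F G}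
  {P : Type*} [TopologicalSpace P] [ChartedSpace G P]

/-! Everything follows from the covariant derivative of `∂_t` in the warped product, split along
`∂_t = T + ξ` into tangential and normal parts.

In a coordinate frame adapted to the product, the scalar products of `∂_t` with the frame are
constant, so Koszul's formula for `2⟨∇̄_V ∂_t, W⟩` keeps only the `∂_t`-derivative of `⟨V, W⟩`. Only
the factor `a²` contributes to it, and the outcome is `∇̄_V ∂_t = (a'/a)(V - dt(V) ∂_t)`
(`nabla_partialT`). On `M` one has `⟨T, v⟩ = ε dt(df v) = ⟨∂_t, df v⟩`. This makes `ξ` normal, and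
since `ε² = 1` it turns `dt(df X)` into `ε⟨X, T⟩`, which is formula 1.

By the Gauss and Weingarten formulas, the tangential part of `∇̄_X(T + ξ)` is `∇_X T - A_ξ X` and
its normal part is `α(X, T) + ∇^⊥_X ξ` (`derivative_of_restriction`). Comparing with the two parts
of formula 1 gives formulas 2 and 3.

The Gauss and Weingarten formulas rest on three facts about `covAlong`: a Leibniz rule
(`covAlong_smul`), compatibility with the metric (`mvfderiv_val_along`), and symmetry on
pushed-forward coordinate fields (`covAlong_push_localExtension_symm`). The last two give the
tangential part of the ambient derivative the properties that determine the Levi-Civita connection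
of `M`. -/

theorem trivializationAt_tangent_baseSet_mem_nhds [IsManifold J 1 P] (x : P) :
    (trivializationAt F (TangentSpace J) x).baseSet ∈ 𝓝 x :=
  (trivializationAt F (TangentSpace J) x).open_baseSet.mem_nhds
    (FiberBundle.mem_baseSet_trivializationAt' x)

/-- The tangent bundle is trivialized by the derivative of the chart, so `localExtension v` is a
coordinate field: a constant vector transported by the inverse chart. -/
theorem localExtension_eq_mfderivWithin_symm [IsManifold J 1 P] {x y : P} (v : TangentSpace J x)
    (hy : y ∈ (chartAt G x).source) :
    localExtension v y = mfderivWithin 𝓘(ℝ, F) J (extChartAt J x).symm (Set.range J)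
      (extChartAt J x y)
      ((trivializationAt F (TangentSpace J) x).continuousLinearMapAt ℝ x v) := by
  rw [localExtension, TangentBundle.symmL_trivializationAt hy]
  rfl

/-- Read in the chart at `x`, both fields are constant, and constant fields commute. This removes
every bracket term from the torsion and Koszul identities used later. -/
theorem mlieBracket_localExtension [IsManifold J 1 P] {x : P} (v w : TangentSpace J x) :
    VectorField.mlieBracket J (localExtension v) (localExtension w) x = 0 := by
  have key (u : TangentSpace J x) : VectorField.mpullbackWithin 𝓘(ℝ, F) J (extChartAt J x).symm
      (localExtension u) (Set.range J) =ᶠ[𝓝[Set.range J] (extChartAt J x x)]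
      fun _ ↦ (trivializationAt F (TangentSpace J) x).continuousLinearMapAt ℝ x u := by
    filter_upwards [extChartAt_target_mem_nhdsWithin (I := J) x] with z hz
    have hs : (extChartAt J x).symm z ∈ (chartAt G x).source := by
      rw [← extChartAt_source J]; exact (extChartAt J x).map_target hz
    have hinv := isInvertible_mfderivWithin_extChartAt_symm (I := J) hz
    rw [VectorField.mpullbackWithin_apply, localExtension_eq_mfderivWithin_symm u hs,
      (extChartAt J x).right_inv hz]
    obtain ⟨e, he⟩ := hinv
    rw [← he, ContinuousLinearMap.inverse_equiv]
    exact e.symm_apply_apply _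
  rw [← VectorField.mlieBracketWithin_univ, VectorField.mlieBracketWithin_apply]
  rw [Set.preimage_univ, Set.univ_inter,
    Filter.EventuallyEq.lieBracketWithin_vectorField_eq_of_mem (key v) (key w)
      (Set.mem_range_self _)]
  have h0 : VectorField.lieBracketWithin ℝ
      (fun _ ↦ (trivializationAt F (TangentSpace J) x).continuousLinearMapAt ℝ x v)
      (fun _ ↦ (trivializationAt F (TangentSpace J) x).continuousLinearMapAt ℝ x w)
      (Set.range J) (extChartAt J x x) = 0 := by
    simp [VectorField.lieBracketWithin]
  rw [h0]
  exact map_zero _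

end LocalExtension

/-! ### The metric in local coordinates. -/

section Gram

variable {F : Type*} [NormedAddCommGroup F] [NormedSpace ℝ F]
  {G : Type*} [TopologicalSpace G] {J : ModelWithCorners ℝ F G}
  {P : Type*} [TopologicalSpace P] [ChartedSpace G P] [IsManifold J ∞ P]

/-- The matrix of the metric in the local frame of the tangent bundle around `x`. -/
noncomputable def SemiRiemannianMetric.gram (g : SemiRiemannianMetric J P) (x y : P) : F →L[ℝ] F →L[ℝ] ℝ :=
  pullbackForm (g.val y) ((trivializationAt F (TangentSpace J) x).symmL ℝ y)

theorem SemiRiemannianMetric.gram_apply (g : SemiRiemannianMetric J P) (x y : P) (u w : F) :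
    g.gram x y u w = g.val y ((trivializationAt F (TangentSpace J) x).symmL ℝ y u)
      ((trivializationAt F (TangentSpace J) x).symmL ℝ y w) := rfl

/-- On the base set, the trivialization of the bundle of bilinear forms is precomposition of both
arguments with `symmL`. The Gram form is therefore the local reading of the smooth section `g`. -/
theorem SemiRiemannianMetric.contMDiffAt_gram (g : SemiRiemannianMetric J P) (x : P) :
    ContMDiffAt J 𝓘(ℝ, F →L[ℝ] F →L[ℝ] ℝ) ∞ (g.gram x) x := by
  refine ((contMDiffAt_section _).1 (g.contMDiff x)).congr_of_eventuallyEq ?_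
  filter_upwards [trivializationAt_tangent_baseSet_mem_nhds (J := J) x] with y hy
  ext u w
  simp only [hom_trivializationAt_apply, ContinuousLinearMap.inCoordinates,
    ContinuousLinearMap.comp_apply, Trivialization.continuousLinearMapAt_apply]
  rw [linearMapAt_dual_apply hy]
  rfl

theorem symmL_trivialization_apply {x y : P}
    (hy : y ∈ (trivializationAt F (TangentSpace J) x).baseSet) (v : TangentSpace J y) :
    (trivializationAt F (TangentSpace J) x).symmL ℝ y
      (trivializationAt F (TangentSpace J) x (TotalSpace.mk' F y v)).2 = v := by
  have h1 := (trivializationAt F (TangentSpace J) x).symmL_continuousLinearMapAt (R := ℝ) hy v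
  rwa [Trivialization.continuousLinearMapAt_apply, Trivialization.linearMapAt_apply,
    if_pos hy] at h1

theorem trivialization_symmL_apply {x y : P}
    (hy : y ∈ (trivializationAt F (TangentSpace J) x).baseSet) (u : F) :
    (trivializationAt F (TangentSpace J) x (TotalSpace.mk' F y
      ((trivializationAt F (TangentSpace J) x).symmL ℝ y u))).2 = u := by
  have h1 := (trivializationAt F (TangentSpace J) x).continuousLinearMapAt_symmL (R := ℝ) hy u
  rwa [Trivialization.continuousLinearMapAt_apply, Trivialization.linearMapAt_apply,
    if_pos hy] at h1

theorem SemiRiemannianMetric.gram_reading (g : SemiRiemannianMetric J P) {x y : P}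
    (hy : y ∈ (trivializationAt F (TangentSpace J) x).baseSet) (v w : TangentSpace J y) :
    g.gram x y (trivializationAt F (TangentSpace J) x (TotalSpace.mk' F y v)).2
      (trivializationAt F (TangentSpace J) x (TotalSpace.mk' F y w)).2 = g.val y v w := by
  rw [g.gram_apply, symmL_trivialization_apply hy, symmL_trivialization_apply hy]

end Gram

/-! ### Vector fields along a map. -/

section Along

variable {E : Type*} [NormedAddCommGroup E] [NormedSpace ℝ E]
  {H : Type*} [TopologicalSpace H] {I : ModelWithCorners ℝ E H}
  {M : Type*} [TopologicalSpace M] [ChartedSpace H M]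
  {F : Type*} [NormedAddCommGroup F] [NormedSpace ℝ F]
  {G : Type*} [TopologicalSpace G] {J : ModelWithCorners ℝ F G}
  {P : Type*} [TopologicalSpace P] [ChartedSpace G P] [IsManifold J ∞ P]

theorem mdiffAt_along_smul {f : M → P} {σ : Π x : M, TangentSpace J (f x)} {h : M → ℝ} {x : M}
    (hh : MDiffAt h x)
    (hσ : MDifferentiableAt I J.tangent (fun y ↦ TotalSpace.mk' F (f y) (σ y)) x) :
    MDifferentiableAt I J.tangent (fun y ↦ TotalSpace.mk' F (f y) ((h • σ) y)) x := by
  have hf : MDifferentiableAt I J f x := ((mdifferentiableAt_totalSpace _ _).1 hσ).1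
  refine (mdifferentiableAt_totalSpace _ _).2 ⟨hf, ?_⟩
  refine (hh.smul (mdiffAt_reading hσ)).congr_of_eventuallyEq ?_
  filter_upwards [hf.continuousAt.preimage_mem_nhds
    (trivializationAt_tangent_baseSet_mem_nhds (J := J) (f x))] with y hy
  exact ((trivializationAt F (TangentSpace J) (f x)).linear ℝ hy).map_smul (h y) (σ y)

theorem mdiffAt_along_add {f : M → P} {σ τ : Π x : M, TangentSpace J (f x)} {x : M}
    (hσ : MDifferentiableAt I J.tangent (fun y ↦ TotalSpace.mk' F (f y) (σ y)) x)
    (hτ : MDifferentiableAt I J.tangent (fun y ↦ TotalSpace.mk' F (f y) (τ y)) x) :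
    MDifferentiableAt I J.tangent (fun y ↦ TotalSpace.mk' F (f y) ((σ + τ) y)) x := by
  have hf : MDifferentiableAt I J f x := ((mdifferentiableAt_totalSpace _ _).1 hσ).1
  refine (mdifferentiableAt_totalSpace _ _).2 ⟨hf, ?_⟩
  refine ((mdiffAt_reading hσ).add (mdiffAt_reading hτ)).congr_of_eventuallyEq ?_
  filter_upwards [hf.continuousAt.preimage_mem_nhds
    (trivializationAt_tangent_baseSet_mem_nhds (J := J) (f x))] with y hy
  exact ((trivializationAt F (TangentSpace J) (f x)).linear ℝ hy).map_add (σ y) (τ y)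

/-- The derivative of `h` arises only from the reading of `h • σ` in the trivialization. The
connection term sees just the value at `x`, where `h` is the scalar `h x`. -/
theorem covAlong_smul (nabla : CovariantDerivative J F (TangentSpace J : P → Type _))
    {f : M → P} {σ : Π x : M, TangentSpace J (f x)} {h : M → ℝ} {x : M}
    (hh : MDiffAt h x)
    (hσ : MDifferentiableAt I J.tangent (fun y ↦ TotalSpace.mk' F (f y) (σ y)) x) :
    covAlong (I := I) nabla f (h • σ) x
      = h x • covAlong nabla f σ x + (mvfderiv I h x).smulRight (σ x) := by
  have hf : ContinuousAt f x := ((mdifferentiableAt_totalSpace _ _).1 hσ).1.continuousAt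
  have e : (fun y ↦ (trivializationAt F (TangentSpace J) (f x)
        (TotalSpace.mk' F (f y) ((h • σ) y))).2) =ᶠ[𝓝 x]
      h • (fun y ↦ (trivializationAt F (TangentSpace J) (f x)
        (TotalSpace.mk' F (f y) (σ y))).2) := by
    filter_upwards [hf.preimage_mem_nhds
      (trivializationAt_tangent_baseSet_mem_nhds (J := J) (f x))] with y hy
    exact ((trivializationAt F (TangentSpace J) (f x)).linear ℝ hy).map_smul (h y) (σ y)
  simp only [covAlong]
  rw [mvfderiv_congr e, mvfderiv_smul hh (mdiffAt_reading hσ), Pi.smul_apply', localExtension_smul,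
    nabla.isCovariantDerivativeOn.smul_const _ (mdiffAt_localExtension _)]
  ext X
  simp [symmL_trivialization_apply (FiberBundle.mem_baseSet_trivializationAt' (f x))]
  abel

end Along

/-! ### Metric compatibility along a map. -/

section Compatibility

variable {E : Type*} [NormedAddCommGroup E] [NormedSpace ℝ E]
  {H : Type*} [TopologicalSpace H] {I : ModelWithCorners ℝ E H}
  {M : Type*} [TopologicalSpace M] [ChartedSpace H M]
  {F : Type*} [NormedAddCommGroup F] [NormedSpace ℝ F]
  {G : Type*} [TopologicalSpace G] {J : ModelWithCorners ℝ F G}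
  {P : Type*} [TopologicalSpace P] [ChartedSpace G P] [IsManifold J ∞ P]

theorem mvfderiv_clm_apply {V W : Type*} [NormedAddCommGroup V] [NormedSpace ℝ V]
    [NormedAddCommGroup W] [NormedSpace ℝ W] {A : M → V →L[ℝ] W} {s : M → V} {x : M}
    (hA : MDifferentiableAt I 𝓘(ℝ, V →L[ℝ] W) A x) (hs : MDifferentiableAt I 𝓘(ℝ, V) s x) :
    MDifferentiableAt I 𝓘(ℝ, W) (fun y ↦ A y (s y)) x ∧
    ∀ v, mvfderiv I (fun y ↦ A y (s y)) x v
      = mvfderiv I A x v (s x) + A x (mvfderiv I s x v) := by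
  let dA : E →L[ℝ] V →L[ℝ] W := mvfderiv I A x
  let ds : E →L[ℝ] V := mvfderiv I s x
  have h1 : HasMFDerivAt I 𝓘(ℝ, W) (fun y ↦ A y (s y)) x
      (A x ∘L ds + dA.flip (s x)) := by
    refine ⟨hA.continuousAt.clm_apply hs.continuousAt, ?_⟩
    have h := hA.hasMFDerivAt.2.clm_apply hs.hasMFDerivAt.2
    refine h.congr_fderiv ?_
    simp only [writtenInExtChartAt, Function.comp_apply, extChartAt_to_inv]
    rfl
  refine ⟨h1.mdifferentiableAt, fun v ↦ (congr($(h1.mfderiv) v)).trans ?_⟩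
  change A x (mvfderiv I s x v) + mvfderiv I A x v (s x) = _
  rw [add_comm]

/-- The first term keeps both arguments frozen at `x`, instead of differentiating `A` as an
operator: in that shape it becomes the derivative of a scalar product of two coordinate fields. -/
theorem mvfderiv_bilin_apply {A : M → F →L[ℝ] F →L[ℝ] ℝ} {s t : M → F} {x : M}
    (hA : MDifferentiableAt I 𝓘(ℝ, F →L[ℝ] F →L[ℝ] ℝ) A x)
    (hs : MDifferentiableAt I 𝓘(ℝ, F) s x) (ht : MDifferentiableAt I 𝓘(ℝ, F) t x)
    (v : TangentSpace I x) :
    mvfderiv I (fun y ↦ A y (s y) (t y)) x v = mvfderiv I (fun y ↦ A y (s x) (t x)) x v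
      + A x (mvfderiv I s x v) (t x) + A x (s x) (mvfderiv I t x v) := by
  have hsx := mvfderiv_clm_apply hA (mdifferentiableAt_const (c := s x))
  rw [(mvfderiv_clm_apply (mvfderiv_clm_apply hA hs).1 ht).2, (mvfderiv_clm_apply hA hs).2,
    (mvfderiv_clm_apply hsx.1 mdifferentiableAt_const).2, hsx.2, mvfderiv_const, mvfderiv_const]
  simp

/-- An identity for every `y`, not only near `x`: both sides apply the same `symmL` at `y` to
vectors that do not depend on `y`. -/
theorem SemiRiemannianMetric.val_localExtension (g : SemiRiemannianMetric J P) {x : P}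
    (v w : TangentSpace J x) :
    (fun y ↦ g.val y (localExtension v y) (localExtension w y)) = fun y ↦ g.gram x y
      (trivializationAt F (TangentSpace J) x (TotalSpace.mk' F x v)).2
      (trivializationAt F (TangentSpace J) x (TotalSpace.mk' F x w)).2 := by
  funext y
  rw [g.gram_apply, localExtension, localExtension, Trivialization.continuousLinearMapAt_apply,
    Trivialization.linearMapAt_apply, if_pos (FiberBundle.mem_baseSet_trivializationAt' x),
    Trivialization.linearMapAt_apply, if_pos (FiberBundle.mem_baseSet_trivializationAt' x)]

/-- Write `⟨σ, τ⟩` as the Gram form at `f y` applied to the readings of `σ` and `τ`. Differentiating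
the readings gives the first summand of `covAlong`. Differentiating the Gram form with frozen
readings is differentiating the metric on coordinate fields of `P`, where compatibility of `nabla`
supplies the second summand. -/
theorem mvfderiv_val_along {g : SemiRiemannianMetric J P}
    {nabla : CovariantDerivative J F (TangentSpace J : P → Type _)} (hnabla : IsLeviCivita g nabla)
    {f : M → P} {σ τ : Π x : M, TangentSpace J (f x)} {x : M}
    (hσ : MDifferentiableAt I J.tangent (fun y ↦ TotalSpace.mk' F (f y) (σ y)) x)
    (hτ : MDifferentiableAt I J.tangent (fun y ↦ TotalSpace.mk' F (f y) (τ y)) x)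
    (v : TangentSpace I x) :
    mvfderiv I (fun y ↦ g.val (f y) (σ y) (τ y)) x v
      = g.val (f x) (covAlong nabla f σ x v) (τ x) + g.val (f x) (σ x) (covAlong nabla f τ x v) := by
  have hf : MDifferentiableAt I J f x := ((mdifferentiableAt_totalSpace _ _).1 hσ).1
  have hG := ((g.contMDiffAt_gram (f x)).mdifferentiableAt (by simp))
  have hA : MDifferentiableAt I 𝓘(ℝ, F →L[ℝ] F →L[ℝ] ℝ) (fun y ↦ g.gram (f x) (f y)) x :=
    hG.comp x hf
  have hx := FiberBundle.mem_baseSet_trivializationAt' (F := F) (E := TangentSpace J) (f x)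
  have e : (fun y ↦ g.val (f y) (σ y) (τ y)) =ᶠ[𝓝 x] fun y ↦ g.gram (f x) (f y)
      (trivializationAt F (TangentSpace J) (f x) (TotalSpace.mk' F (f y) (σ y))).2
      (trivializationAt F (TangentSpace J) (f x) (TotalSpace.mk' F (f y) (τ y))).2 := by
    filter_upwards [hf.continuousAt.preimage_mem_nhds
      (trivializationAt_tangent_baseSet_mem_nhds (J := J) (f x))] with y hy
    exact (g.gram_reading hy _ _).symm
  rw [mvfderiv_congr e, mvfderiv_bilin_apply hA (mdiffAt_reading hσ) (mdiffAt_reading hτ)]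
  -- With frozen readings the function factors through `f`, so the chain rule moves its derivative
  -- to `P`.
  have hconst : mvfderiv I (fun y ↦ g.gram (f x) (f y)
      (trivializationAt F (TangentSpace J) (f x) (TotalSpace.mk' F (f x) (σ x))).2
      (trivializationAt F (TangentSpace J) (f x) (TotalSpace.mk' F (f x) (τ x))).2) x v
      = mvfderiv J (fun p ↦ g.val p (localExtension (σ x) p) (localExtension (τ x) p)) (f x)
          (mfderiv I J f x v) := by
    rw [g.val_localExtension]
    have hd := (mvfderiv_clm_apply (mvfderiv_clm_apply hG (mdifferentiableAt_const (c :=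
      (trivializationAt F (TangentSpace J) (f x) (TotalSpace.mk' F (f x) (σ x))).2))).1
      (mdifferentiableAt_const (c :=
      (trivializationAt F (TangentSpace J) (f x) (TotalSpace.mk' F (f x) (τ x))).2))).1
    exact congr($(mfderiv_comp x hd hf) v)
  rw [hconst, hnabla.compatible _ _ _ _ (mdiffAt_localExtension _) (mdiffAt_localExtension _),
    localExtension_self, localExtension_self, g.gram_apply, g.gram_apply,
    symmL_trivialization_apply hx, symmL_trivialization_apply hx]
  simp only [covAlong, _root_.add_apply, ContinuousLinearMap.comp_apply, map_add]
  ring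

end Compatibility

/-! ### Symmetry of the covariant derivative along a map. -/

section Symmetry

variable {E : Type*} [NormedAddCommGroup E] [NormedSpace ℝ E]
  {H : Type*} [TopologicalSpace H] {I : ModelWithCorners ℝ E H} [I.Boundaryless]
  {M : Type*} [TopologicalSpace M] [ChartedSpace H M] [IsManifold I ∞ M]
  {F : Type*} [NormedAddCommGroup F] [NormedSpace ℝ F]
  {G : Type*} [TopologicalSpace G] {J : ModelWithCorners ℝ F G}
  {P : Type*} [TopologicalSpace P] [ChartedSpace G P] [IsManifold J ∞ P]

/-- In charts, the push-forward of a coordinate field is the derivative of the coordinate expression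
of `f` in a fixed direction. Without boundary the range of `I` is everything, so the ordinary
`fderiv` can be used. -/
theorem reading_mfderiv_localExtension {f : M → P} (hf : ContMDiff I J ∞ f) {x : M}
    (v : TangentSpace I x) :
    (fun y ↦ (trivializationAt F (TangentSpace J) (f x)
        (TotalSpace.mk' F (f y) (mfderiv I J f y (localExtension v y)))).2) =ᶠ[𝓝 x]
      fun y ↦ fderiv ℝ (writtenInExtChartAt I J x f) (extChartAt I x y)
        ((trivializationAt E (TangentSpace I) x).continuousLinearMapAt ℝ x v) := by
  filter_upwards [hf.continuous.continuousAt.preimage_mem_nhds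
      (trivializationAt_tangent_baseSet_mem_nhds (J := J) (f x)),
    trivializationAt_tangent_baseSet_mem_nhds (J := I) x] with y hy hx
  have hy' : f y ∈ (chartAt G (f x)).source := hy
  have hx' : y ∈ (chartAt H x).source := hx
  have hxe : y ∈ (extChartAt I x).source := by rwa [extChartAt_source]
  have hz := (extChartAt I x).map_source hxe
  have h1 := Trivialization.linearMapAt_apply (R := ℝ) (trivializationAt F (TangentSpace J) (f x))
    (b := f y) (mfderiv I J f y (localExtension v y))
  rw [if_pos (show f y ∈ _ from hy)] at h1
  rw [← h1, ← Trivialization.continuousLinearMapAt_apply,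
    TangentBundle.continuousLinearMapAt_trivializationAt hy',
    localExtension_eq_mfderivWithin_symm v hx', ← mfderiv_eq_fderiv]
  have hsymm := mdifferentiableWithinAt_extChartAt_symm (I := I) hz
  have hfy : MDifferentiableAt I J f y := (hf _).mdifferentiableAt (by simp)
  have hψ : MDifferentiableAt J 𝓘(ℝ, F) (extChartAt J (f x)) (f y) :=
    mdifferentiableAt_extChartAt hy'
  have hl := (extChartAt I x).left_inv hxe
  rw [I.range_eq_univ, mdifferentiableWithinAt_univ] at hsymm
  rw [I.range_eq_univ, mfderivWithin_univ]
  -- The point obtained by applying the chart and its inverse equals `y` only propositionally, while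
  -- the tangent spaces depend on it. Quantifying over `p = y` permits the substitution.
  have hψf : ∀ p, p = y → ∀ u : E, (mfderiv I 𝓘(ℝ, F) (extChartAt J (f x) ∘ f) p u : F)
      = mfderiv J 𝓘(ℝ, F) (extChartAt J (f x)) (f y) (mfderiv I J f y u) := by
    rintro _ rfl u
    exact congr($(mfderiv_comp _ hψ hfy) u)
  have hc := mfderiv_comp_of_eq (hψ.comp y hfy) hsymm hl
  exact ((congr($hc _)).trans (hψf _ hl _)).symm

/-- The reading part is a second derivative of the coordinate expression of `f`, symmetric by
Schwarz. The connection part is symmetric because `nabla` is torsion free and coordinate fields of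
`P` commute at `f x`. -/
theorem covAlong_push_localExtension_symm
    {g : SemiRiemannianMetric J P}
    {nabla : CovariantDerivative J F (TangentSpace J : P → Type _)} (hnabla : IsLeviCivita g nabla)
    {f : M → P} (hf : ContMDiff I J ∞ f) {x : M}
    (v w : TangentSpace I x) :
    covAlong (I := I) nabla f (fun y ↦ mfderiv I J f y (localExtension v y)) x w
      = covAlong nabla f (fun y ↦ mfderiv I J f y (localExtension w y)) x v := by
  have hF : ContDiffAt ℝ ∞ (writtenInExtChartAt I J x f) (extChartAt I x x) := by
    have h := (contMDiffAt_iff.1 (hf x)).2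
    rw [I.range_eq_univ, contDiffWithinAt_univ] at h
    exact h
  have hF1 : DifferentiableAt ℝ (fderiv ℝ (writtenInExtChartAt I J x f)) (extChartAt I x x) :=
    (hF.fderiv_right (m := 1) (by norm_cast)).differentiableAt one_ne_zero
  have hd (v w : TangentSpace I x) : mvfderiv I (fun y ↦ (trivializationAt F (TangentSpace J) (f x)
        (TotalSpace.mk' F (f y) (mfderiv I J f y (localExtension v y)))).2) x w
      = fderiv ℝ (fderiv ℝ (writtenInExtChartAt I J x f)) (extChartAt I x x)
        ((trivializationAt E (TangentSpace I) x).continuousLinearMapAt ℝ x w)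
        ((trivializationAt E (TangentSpace I) x).continuousLinearMapAt ℝ x v) := by
    rw [mvfderiv_congr (reading_mfderiv_localExtension hf v)]
    have hA := hF1.hasFDerivAt.hasMFDerivAt.comp x
      (mdifferentiableAt_extChartAt (I := I) (mem_chart_source H x)).hasMFDerivAt
    refine ((mvfderiv_clm_apply hA.mdifferentiableAt mdifferentiableAt_const).2 w).trans ?_
    rw [mvfderiv_const, TangentBundle.continuousLinearMapAt_trivializationAt (mem_chart_source H x)]
    refine (add_eq_left.2 (map_zero _)).trans ?_
    exact DFunLike.congr_fun (show _ = (_ : E →L[ℝ] F) from congr($(hA.mfderiv) w)) _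
  have htors := hnabla.torsion_free (localExtension (mfderiv I J f x v))
    (localExtension (mfderiv I J f x w)) (f x) (mdiffAt_localExtension _) (mdiffAt_localExtension _)
  rw [mlieBracket_localExtension, localExtension_self, localExtension_self, sub_eq_zero] at htors
  simp only [covAlong, _root_.add_apply, ContinuousLinearMap.comp_apply, localExtension_self]
  rw [hd, hd, htors, (hF.isSymmSndFDerivAt (by simp; norm_cast)).eq]

end Symmetry

/-! ### Koszul's formula. -/

section Koszul

/-- The algebra behind uniqueness of the Levi-Civita connection, with `D u v w` in the role of `⟨∇_u
v, w⟩`. It is kept abstract so that it applies both to the connection of `M` and to the tangential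
part of the ambient one. -/
theorem koszul_of_symm {V : Type*} {D d : V → V → V → ℝ}
    (hs : ∀ u v w, D u v w = D v u w) (hd : ∀ u v w, D u v w + D u w v = d u v w) (u v w : V) :
    2 * D u v w = d u v w + d v w u - d w u v := by
  linarith [hs u v w, hs u w v, hs v w u, hd u v w, hd v w u, hd w u v]

variable {F : Type*} [NormedAddCommGroup F] [NormedSpace ℝ F]
  {G : Type*} [TopologicalSpace G] {J : ModelWithCorners ℝ F G}
  {P : Type*} [TopologicalSpace P] [ChartedSpace G P] [IsManifold J ∞ P]

theorem IsLeviCivita.koszul_localExtension {g : SemiRiemannianMetric J P}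
    {nabla : CovariantDerivative J F (TangentSpace J : P → Type _)} (hnabla : IsLeviCivita g nabla)
    {x : P} (u v w : TangentSpace J x) :
    2 * g.val x (nabla (localExtension v) x u) w
      = mvfderiv J (fun y ↦ g.val y (localExtension v y) (localExtension w y)) x u
        + mvfderiv J (fun y ↦ g.val y (localExtension w y) (localExtension u y)) x v
        - mvfderiv J (fun y ↦ g.val y (localExtension u y) (localExtension v y)) x w := by
  refine koszul_of_symm (V := TangentSpace J x)
    (D := fun u v w ↦ g.val x (nabla (localExtension v) x u) w)
    (d := fun u v w ↦ mvfderiv J (fun y ↦ g.val y (localExtension v y) (localExtension w y)) x u)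
    (fun u v w ↦ ?_) (fun u v w ↦ ?_) u v w
  · have h := hnabla.torsion_free (localExtension u) (localExtension v) x
      (mdiffAt_localExtension _) (mdiffAt_localExtension _)
    rw [mlieBracket_localExtension, localExtension_self, localExtension_self, sub_eq_zero] at h
    simp only [h]
  · rw [hnabla.compatible _ _ _ _ (mdiffAt_localExtension _) (mdiffAt_localExtension _),
      localExtension_self, localExtension_self, g.symm x (nabla (localExtension w) x u)]

end Koszul

/-! ### Gauss and Weingarten formulas. -/

section Submanifold

variable {E : Type*} [NormedAddCommGroup E] [NormedSpace ℝ E] [FiniteDimensional ℝ E]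
  {H : Type*} [TopologicalSpace H] {I : ModelWithCorners ℝ E H}
  {M : Type*} [TopologicalSpace M] [ChartedSpace H M] [IsManifold I ∞ M]
  {F : Type*} [NormedAddCommGroup F] [NormedSpace ℝ F]
  {G : Type*} [TopologicalSpace G] {J : ModelWithCorners ℝ F G}
  {P : Type*} [TopologicalSpace P] [ChartedSpace G P] [IsManifold J ∞ P]
  {g : SemiRiemannianMetric I M} {gP : SemiRiemannianMetric J P}

namespace IsometricImmersion

theorem val_tangential (f : IsometricImmersion g gP) (x : M) (w : TangentSpace J (f.toFun x))
    (v : TangentSpace I x) :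
    g.val x (f.tangential x w) v = gP.val (f.toFun x) w (mfderiv I J f.toFun x v) := by
  simp [tangential, g.val_sharp]

theorem tangential_mfderiv (f : IsometricImmersion g gP) (x : M) (v : TangentSpace I x) :
    f.tangential x (mfderiv I J f.toFun x v) = v :=
  g.eq_of_val_eq fun w ↦ by rw [val_tangential, f.isometric]

theorem tangential_of_isNormal (f : IsometricImmersion g gP) {x : M}
    {w : TangentSpace J (f.toFun x)} (hw : f.IsNormal x w) : f.tangential x w = 0 :=
  g.eq_of_val_eq fun v ↦ by rw [val_tangential, hw v, map_zero]; rfl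

theorem normal_apply (f : IsometricImmersion g gP) (x : M) (w : TangentSpace J (f.toFun x)) :
    f.normal x w = w - mfderiv I J f.toFun x (f.tangential x w) := rfl

theorem normal_mfderiv (f : IsometricImmersion g gP) (x : M) (v : TangentSpace I x) :
    f.normal x (mfderiv I J f.toFun x v) = 0 := by
  rw [normal_apply, tangential_mfderiv, sub_self]

theorem normal_of_isNormal (f : IsometricImmersion g gP) {x : M}
    {w : TangentSpace J (f.toFun x)} (hw : f.IsNormal x w) : f.normal x w = w := by
  rw [normal_apply, f.tangential_of_isNormal hw, map_zero, sub_zero]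

theorem secondFundamentalForm_apply (f : IsometricImmersion g gP)
    (nablaP : CovariantDerivative J F (TangentSpace J : P → Type _)) (x : M)
    (X Y : TangentSpace I x) : f.secondFundamentalForm nablaP x X Y
      = f.normal x (covAlong nablaP f.toFun (f.push (localExtension Y)) x X) := rfl

theorem isNormal_secondFundamentalForm (f : IsometricImmersion g gP)
    (nablaP : CovariantDerivative J F (TangentSpace J : P → Type _)) (x : M)
    (X Y : TangentSpace I x) : f.IsNormal x (f.secondFundamentalForm nablaP x X Y) :=
  f.normal_orthogonal x _

omit [FiniteDimensional ℝ E] in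
theorem push_smul (f : IsometricImmersion g gP) (h : M → ℝ) (Y : Π x : M, TangentSpace I x) :
    f.push (h • Y) = h • f.push Y := by
  funext y; simp [push]

omit [FiniteDimensional ℝ E] in
theorem push_add (f : IsometricImmersion g gP) (Y Z : Π x : M, TangentSpace I x) :
    f.push (Y + Z) = f.push Y + f.push Z := by
  funext y; simp [push]

variable [I.Boundaryless]

/-- Paired with `w`, each side is symmetric in `u` and `v` and compatible with the metric. As `f` is
isometric, the derivatives of scalar products agree, so Koszul's formula gives both sides the same
value. -/
theorem tangential_covAlong_push_localExtension (f : IsometricImmersion g gP)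
    {nabla : CovariantDerivative I E (TangentSpace I : M → Type _)} (hnabla : IsLeviCivita g nabla)
    {nablaP : CovariantDerivative J F (TangentSpace J : P → Type _)}
    (hnablaP : IsLeviCivita gP nablaP) {x : M} (u v : TangentSpace I x) :
    f.tangential x (covAlong nablaP f.toFun (f.push (localExtension v)) x u)
      = nabla (localExtension v) x u := by
  refine g.eq_of_val_eq fun w ↦ ?_
  rw [val_tangential]
  have h1 := hnabla.koszul_localExtension u v w
  have h2 := koszul_of_symm (V := TangentSpace I x)
    (D := fun u v w ↦ gP.val (f.toFun x)
      (covAlong nablaP f.toFun (f.push (localExtension v)) x u) (mfderiv I J f.toFun x w))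
    (d := fun u v w ↦ mvfderiv I (fun y ↦ g.val y (localExtension v y) (localExtension w y)) x u)
    (fun u v w ↦ ?_) (fun u v w ↦ ?_) u v w
  · linarith
  · rw [show covAlong nablaP f.toFun (f.push (localExtension v)) x u = _ from
      covAlong_push_localExtension_symm hnablaP f.contMDiff v u]
    rfl
  · have e : (fun y ↦ g.val y (localExtension v y) (localExtension w y)) = fun y ↦
        gP.val (f.toFun y) (f.push (localExtension v) y) (f.push (localExtension w) y) := by
      funext y; exact (f.isometric y _ _).symm
    rw [e, mvfderiv_val_along hnablaP (f.mdiffAt_push (mdiffAt_localExtension v))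
      (f.mdiffAt_push (mdiffAt_localExtension w)),
      gP.symm _ (covAlong nablaP f.toFun (f.push (localExtension w)) x u)]
    simp only [push, localExtension_self]

/-- The difference `∇̄_X(f_* Y) - df(∇_X Y)` is tensorial in `Y`, because the Leibniz terms cancel.
Hence `Y` may be replaced by the coordinate field through `Y x`, for which the tangential part is
known and the rest is `α` by definition. -/
theorem gauss_formula (f : IsometricImmersion g gP)
    {nabla : CovariantDerivative I E (TangentSpace I : M → Type _)} (hnabla : IsLeviCivita g nabla)
    {nablaP : CovariantDerivative J F (TangentSpace J : P → Type _)}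
    (hnablaP : IsLeviCivita gP nablaP) {Y : Π x : M, TangentSpace I x} {x : M}
    (hY : MDiffAt (T% Y) x) (X : TangentSpace I x) :
    covAlong nablaP f.toFun (f.push Y) x X
      = mfderiv I J f.toFun x (nabla Y x X) + f.secondFundamentalForm nablaP x X (Y x) := by
  let Φ : (Π x : M, TangentSpace I x) → TangentSpace J (f.toFun x) := fun Z ↦
    covAlong nablaP f.toFun (f.push Z) x X - mfderiv I J f.toFun x (nabla Z x X)
  have hΦ : TensorialAt I E Φ x := by
    refine ⟨fun {h Z} hh hZ ↦ ?_, fun {Z Z'} hZ hZ' ↦ ?_⟩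
    · simp only [Φ]
      rw [push_smul, covAlong_smul nablaP hh (f.mdiffAt_push hZ),
        nabla.isCovariantDerivativeOn.leibniz hZ hh]
      simp [push, smul_sub]
    · simp only [Φ]
      rw [push_add, covAlong_add nablaP (f.mdiffAt_push hZ) (f.mdiffAt_push hZ'),
        nabla.isCovariantDerivativeOn.add hZ hZ']
      simp
      abel
  have key := hΦ.pointwise hY (mdiffAt_localExtension (Y x)) (localExtension_self _).symm
  simp only [Φ] at key
  rw [← f.tangential_covAlong_push_localExtension hnabla hnablaP, ← normal_apply,
    ← secondFundamentalForm_apply] at key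
  rw [← key]
  abel

omit [I.Boundaryless] in
-- Differentiate `⟨η, f_* V⟩ = 0` with `V` a coordinate field.
theorem weingarten_formula (f : IsometricImmersion g gP)
    {nablaP : CovariantDerivative J F (TangentSpace J : P → Type _)}
    (hnablaP : IsLeviCivita gP nablaP) {η : Π x : M, TangentSpace J (f.toFun x)} {x : M}
    (hη : MDifferentiableAt I J.tangent (fun y ↦ TotalSpace.mk' F (f.toFun y) (η y)) x)
    (hn : ∀ y, f.IsNormal y (η y)) (X : TangentSpace I x) :
    f.tangential x (covAlong nablaP f.toFun η x X) = - f.shapeOperator nablaP x (η x) X := by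
  refine g.eq_of_val_eq fun v ↦ ?_
  have h := mvfderiv_val_along hnablaP hη (f.mdiffAt_push (mdiffAt_localExtension v)) X
  have e : (fun y ↦ gP.val (f.toFun y) (η y) (f.push (localExtension v) y)) = fun _ ↦ 0 :=
    funext fun y ↦ hn y _
  rw [e, mvfderiv_const] at h
  -- Only the normal part of `∇̄_X(f_* V)` pairs nontrivially with `η`, and that part is `α(X, v)`.
  have h3 : covAlong nablaP f.toFun (f.push (localExtension v)) x X
      = f.secondFundamentalForm nablaP x X v + mfderiv I J f.toFun x (f.tangential x
        (covAlong nablaP f.toFun (f.push (localExtension v)) x X)) := by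
    rw [secondFundamentalForm_apply, normal_apply]; abel
  have h4 : g.val x (f.shapeOperator nablaP x (η x) X) v
      = gP.val (f.toFun x) (η x) (f.secondFundamentalForm nablaP x X v) := by
    rw [shapeOperator, g.val_sharp]; rfl
  rw [h3, map_add, hn x _, add_zero] at h
  have h7 : g.val x (- f.shapeOperator nablaP x (η x) X) v
      = - g.val x (f.shapeOperator nablaP x (η x) X) v := by simp
  rw [val_tangential, h7, h4]
  have h5 : f.push (localExtension v) x = mfderiv I J f.toFun x v := by
    simp only [push, localExtension_self]
  rw [h5] at h
  have h6 : (0 : ℝ) = gP.val (f.toFun x) (covAlong nablaP f.toFun η x X) (mfderiv I J f.toFun x v)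
    + gP.val (f.toFun x) (η x) (f.secondFundamentalForm nablaP x X v) := h
  linarith

/-- Derivatives of the tangential and the normal part of the restriction to a submanifold of an
ambient vector field. -/
theorem derivative_of_restriction [FiniteDimensional ℝ F] (f : IsometricImmersion g gP)
    {nabla : CovariantDerivative I E (TangentSpace I : M → Type _)} (hnabla : IsLeviCivita g nabla)
    {nablaP : CovariantDerivative J F (TangentSpace J : P → Type _)}
    (hnablaP : IsLeviCivita gP nablaP) {Z : Π p : P, TangentSpace J p}
    {T : Π x : M, TangentSpace I x} {ξ : Π x : M, TangentSpace J (f.toFun x)} {x : M}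
    (hZ : MDiffAt (T% Z) (f.toFun x)) (hT : MDiffAt (T% T) x)
    (hn : ∀ y, f.IsNormal y (ξ y)) (h : ∀ y, Z (f.toFun y) = mfderiv I J f.toFun y (T y) + ξ y)
    (X : TangentSpace I x) :
    f.tangential x (nablaP Z (f.toFun x) (mfderiv I J f.toFun x X))
      = nabla T x X - f.shapeOperator nablaP x (ξ x) X ∧
    f.normal x (nablaP Z (f.toFun x) (mfderiv I J f.toFun x X))
      = f.secondFundamentalForm nablaP x X (T x) + f.normalConnection nablaP ξ x X := by
  have hf : MDifferentiableAt I J f.toFun x := (f.contMDiff x).mdifferentiableAt (by simp)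
  have hZf : MDifferentiableAt I J.tangent
      (fun y ↦ TotalSpace.mk' F (f.toFun y) (Z (f.toFun y))) x := hZ.comp x hf
  have hpT := f.mdiffAt_push hT
  -- Differentiability of `ξ` is inherited from `Z ∘ f` and `T`. The coefficient `-1` is a constant
  -- function to match the shape of `mdiffAt_along_smul`.
  have hξ : ξ = (fun y ↦ Z (f.toFun y)) + (fun _ : M ↦ (-1 : ℝ)) • f.push T := by
    funext y
    simp [h y, push]
  have hξd : MDifferentiableAt I J.tangent (fun y ↦ TotalSpace.mk' F (f.toFun y) (ξ y)) x := by
    rw [hξ]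
    exact mdiffAt_along_add hZf (mdiffAt_along_smul mdifferentiableAt_const hpT)
  have hZe : (fun y ↦ Z (f.toFun y)) = f.push T + ξ := funext h
  have hcov := covAlong_add nablaP hpT hξd
  rw [← hZe, covAlong_comp nablaP hf hZ] at hcov
  have hX : nablaP Z (f.toFun x) (mfderiv I J f.toFun x X)
      = mfderiv I J f.toFun x (nabla T x X) + f.secondFundamentalForm nablaP x X (T x)
        + covAlong nablaP f.toFun ξ x X := by
    rw [← f.gauss_formula hnabla hnablaP hT]
    exact congr($hcov X)
  constructor
  · rw [hX, map_add, map_add, tangential_mfderiv,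
      f.tangential_of_isNormal (f.isNormal_secondFundamentalForm nablaP x X _),
      f.weingarten_formula hnablaP hξd hn, add_zero, sub_eq_add_neg]
  · rw [hX, map_add, map_add, normal_mfderiv,
      f.normal_of_isNormal (f.isNormal_secondFundamentalForm nablaP x X _), zero_add]
    rfl

end IsometricImmersion

end Submanifold

/-! ### Differentiability of the gradient. -/

section Gradient

variable {E : Type*} [NormedAddCommGroup E] [NormedSpace ℝ E] [FiniteDimensional ℝ E]
  {H : Type*} [TopologicalSpace H] {I : ModelWithCorners ℝ E H}
  {M : Type*} [TopologicalSpace M] [ChartedSpace H M] [IsManifold I ∞ M]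

omit [FiniteDimensional ℝ E] [IsManifold I ∞ M] in
theorem mdifferentiableAt_clm_inverse {V W : Type*} [NormedAddCommGroup V] [NormedSpace ℝ V]
    [CompleteSpace V] [NormedAddCommGroup W] [NormedSpace ℝ W] {A : M → V →L[ℝ] W} {x : M}
    (hA : MDifferentiableAt I 𝓘(ℝ, V →L[ℝ] W) A x) {e : V ≃L[ℝ] W}
    (he : (e : V →L[ℝ] W) = A x) :
    MDifferentiableAt I 𝓘(ℝ, W →L[ℝ] V) (fun y ↦ (A y).inverse) x := by
  have h1 : DifferentiableAt ℝ (ContinuousLinearMap.inverse : (V →L[ℝ] W) → _) (A x) := by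
    rw [← he]
    exact (contDiffAt_map_inverse (n := 1) e).differentiableAt one_ne_zero
  exact h1.mdifferentiableAt.comp x hA

/-- Nondegeneracy makes the Gram form injective into the dual, and the dimensions agree. -/
theorem SemiRiemannianMetric.exists_equiv_gram (g : SemiRiemannianMetric I M) {x y : M}
    (hy : y ∈ (trivializationAt E (TangentSpace I) x).baseSet) :
    ∃ e : E ≃L[ℝ] (E →L[ℝ] ℝ), (e : E →L[ℝ] E →L[ℝ] ℝ) = g.gram x y := by
  have hinj : Function.Injective (g.gram x y) := by
    refine (injective_iff_map_eq_zero _).2 fun u hu ↦ ?_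
    have h : (trivializationAt E (TangentSpace I) x).symmL ℝ y u = 0 := by
      refine g.nondegenerate y _ fun w ↦ ?_
      have := g.gram_apply x y u (trivializationAt E (TangentSpace I) x (TotalSpace.mk' E y w)).2
      rw [symmL_trivialization_apply hy, hu] at this
      exact this.symm
    have h2 := trivialization_symmL_apply hy u
    rw [h] at h2
    rw [← h2]
    exact ((trivializationAt E (TangentSpace I) x).linear ℝ hy).map_zero
  have hfr : Module.finrank ℝ E = Module.finrank ℝ (E →L[ℝ] ℝ) := by
    rw [← (LinearMap.toContinuousLinearMap (𝕜 := ℝ) (E := E) (F' := ℝ)).finrank_eq]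
    exact (Subspace.dual_finrank_eq).symm
  exact ⟨(LinearEquiv.ofInjectiveOfFinrankEq (g.gram x y).toLinearMap hinj
    hfr).toContinuousLinearEquiv, by ext; rfl⟩

/-- In coordinates the gradient is the inverse Gram matrix applied to `dh`, and inversion is
differentiable at an invertible operator. -/
theorem SemiRiemannianMetric.mdiffAt_grad (g : SemiRiemannianMetric I M) {h : M → ℝ}
    (hh : ContMDiff I 𝓘(ℝ, ℝ) ∞ h) (x : M) : MDiffAt (T% (g.grad h)) x := by
  refine (mdifferentiableAt_section ..).2 ?_
  have hx := FiberBundle.mem_baseSet_trivializationAt' (F := E) (E := TangentSpace I) x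
  obtain ⟨e, he⟩ := g.exists_equiv_gram hx
  have hd : MDifferentiableAt I 𝓘(ℝ, E →L[ℝ] ℝ)
      (inTangentCoordinates I 𝓘(ℝ, ℝ) id h (mfderiv I 𝓘(ℝ, ℝ) h) x) x :=
    ((hh x).mfderiv_const (m := 1) (by norm_cast)).mdifferentiableAt one_ne_zero
  have hinv := mdifferentiableAt_clm_inverse
    ((g.contMDiffAt_gram x).mdifferentiableAt (by simp)) he
  refine (mvfderiv_clm_apply hinv hd).1.congr_of_eventuallyEq ?_
  filter_upwards [trivializationAt_tangent_baseSet_mem_nhds (J := I) x] with y hy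
  -- The Gram form is invertible on the whole base set, so `inverse` does not take its default value
  -- `0` near `x`.
  obtain ⟨e', he'⟩ := g.exists_equiv_gram hy
  rw [← he', ContinuousLinearMap.inverse_equiv, ContinuousLinearEquiv.coe_coe,
    ContinuousLinearEquiv.eq_symm_apply, ← ContinuousLinearEquiv.coe_coe, he']
  ext w
  rw [g.gram_apply, symmL_trivialization_apply hy, grad, g.val_sharp]
  simp [inTangentCoordinates, ContinuousLinearMap.inCoordinates]
  rfl

end Gradient

/-! ### The field `∂_t` in a warped product. -/

section Warped

variable {F : Type*} [NormedAddCommGroup F] [NormedSpace ℝ F]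
  {G : Type*} [TopologicalSpace G] {J : ModelWithCorners ℝ F G}
  {P : Type*} [TopologicalSpace P] [ChartedSpace G P] [IsManifold J ∞ P]

theorem localExtension_zero (x : P) : localExtension (0 : TangentSpace J x) = 0 := by
  funext y
  simp [localExtension]

theorem SemiRiemannianMetric.val_localExtension_self (g : SemiRiemannianMetric J P) {x : P}
    (v w : TangentSpace J x) :
    g.val x (localExtension v x) (localExtension w x) = g.val x v w := by
  rw [localExtension_self, localExtension_self]

theorem SemiRiemannianMetric.mdifferentiableAt_val_localExtension (g : SemiRiemannianMetric J P)
    {x : P} (v w : TangentSpace J x) :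
    MDifferentiableAt J 𝓘(ℝ, ℝ) (fun y ↦ g.val y (localExtension v y) (localExtension w y)) x := by
  have hG := (g.contMDiffAt_gram x).mdifferentiableAt (by simp)
  rw [g.val_localExtension]
  exact (mvfderiv_clm_apply (mvfderiv_clm_apply hG mdifferentiableAt_const).1
    mdifferentiableAt_const).1

theorem hasMFDerivAt_extChartAt_opens (S : TopologicalSpace.Opens ℝ) (t₀ t : S) :
    HasMFDerivAt 𝓘(ℝ, ℝ) 𝓘(ℝ, ℝ) (extChartAt 𝓘(ℝ, ℝ) t₀) t (ContinuousLinearMap.id ℝ ℝ) := by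
  have h : (extChartAt 𝓘(ℝ, ℝ) t₀ : S → ℝ) = Subtype.val := by
    funext s
    simp
    rfl
  rw [h]
  exact hasMFDerivAt_subtype_val t

/-- The chart of `S × P` is a product whose first factor is the inclusion of `S` in `ℝ`. The time
component of a vector is therefore its own coordinate. -/
theorem continuousLinearMapAt_prod (S : TopologicalSpace.Opens ℝ) {p y : S × P}
    (hy : y ∈ (trivializationAt (ℝ × F) (TangentSpace (𝓘(ℝ, ℝ).prod J)) p).baseSet)
    (V : TangentSpace (𝓘(ℝ, ℝ).prod J) y) :
    (trivializationAt (ℝ × F) (TangentSpace (𝓘(ℝ, ℝ).prod J)) p).continuousLinearMapAt ℝ y V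
      = ((V : ℝ × F).1, (trivializationAt F (TangentSpace J) p.2).continuousLinearMapAt ℝ y.2
          (V : ℝ × F).2) := by
  have hy' : y ∈ (chartAt (ModelProd ℝ G) p).source := hy
  have hy2 : y.2 ∈ (chartAt G p.2).source := by
    rw [prodChartedSpace_chartAt] at hy'
    exact hy'.2
  rw [TangentBundle.continuousLinearMapAt_trivializationAt hy',
    TangentBundle.continuousLinearMapAt_trivializationAt hy2]
  have h1 := (hasMFDerivAt_extChartAt_opens S p.1 y.1).comp y
    (hasMFDerivAt_fst (I := 𝓘(ℝ, ℝ)) (I' := J) y)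
  have h2 := (mdifferentiableAt_extChartAt (I := J) hy2).hasMFDerivAt.comp y
    (hasMFDerivAt_snd (I := 𝓘(ℝ, ℝ)) (I' := J) y)
  have h : HasMFDerivAt (𝓘(ℝ, ℝ).prod J) 𝓘(ℝ, ℝ × F)
      ((extChartAt 𝓘(ℝ, ℝ) p.1).prod (extChartAt J p.2)) y _ :=
    ⟨h1.1.prodMk h2.1, h1.2.prodMk h2.2⟩
  rw [extChartAt_prod]
  exact DFunLike.congr_fun h.mfderiv V

theorem localExtension_prod (S : TopologicalSpace.Opens ℝ) {p y : S × P}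
    (hy : y ∈ (trivializationAt (ℝ × F) (TangentSpace (𝓘(ℝ, ℝ).prod J)) p).baseSet)
    (V : TangentSpace (𝓘(ℝ, ℝ).prod J) p) :
    localExtension V y = ((V : ℝ × F).1,
      localExtension (J := J) (x := p.2) (V : ℝ × F).2 y.2) := by
  have hy2 : y.2 ∈ (trivializationAt F (TangentSpace J) p.2).baseSet := by
    have hy' : y ∈ (chartAt (ModelProd ℝ G) p).source := hy
    rw [prodChartedSpace_chartAt] at hy'
    exact hy'.2
  -- The trivialization is injective on fibres, so it suffices to compare readings.
  have h : (trivializationAt (ℝ × F) (TangentSpace (𝓘(ℝ, ℝ).prod J)) p).continuousLinearMapAt ℝ y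
      (((V : ℝ × F).1, localExtension (J := J) (x := p.2) (V : ℝ × F).2 y.2) : ℝ × F)
      = (trivializationAt (ℝ × F) (TangentSpace (𝓘(ℝ, ℝ).prod J)) p).continuousLinearMapAt ℝ p V
      := by
    refine (continuousLinearMapAt_prod S hy _).trans (Eq.trans ?_ (continuousLinearMapAt_prod S
      (FiberBundle.mem_baseSet_trivializationAt' p) V).symm)
    refine Prod.ext rfl ?_
    exact (trivializationAt F (TangentSpace J) p.2).continuousLinearMapAt_symmL hy2 _
  rw [localExtension, ← h]
  exact (trivializationAt (ℝ × F) (TangentSpace (𝓘(ℝ, ℝ).prod J)) p).symmL_continuousLinearMapAt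
    hy _

/-- Thus `∂_t` is itself a coordinate field, which makes Koszul's formula for coordinate fields
applicable to it. -/
theorem localExtension_partialT (S : TopologicalSpace.Opens ℝ) {p y : S × P}
    (hy : y ∈ (trivializationAt (ℝ × F) (TangentSpace (𝓘(ℝ, ℝ).prod J)) p).baseSet) :
    localExtension (partialT (J := J) S p) y = partialT S y := by
  rw [localExtension_prod S hy]
  refine Prod.ext rfl ?_
  exact congr($(localExtension_zero (J := J) p.2) y.2)

theorem mdiffAt_partialT (S : TopologicalSpace.Opens ℝ) (p : S × P) :
    MDiffAt (T% (partialT (J := J) S : Π q : S × P, TangentSpace (𝓘(ℝ, ℝ).prod J) q)) p := by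
  refine (mdiffAt_localExtension (partialT (J := J) S p)).congr_of_eventuallyEq ?_
  filter_upwards [trivializationAt_tangent_baseSet_mem_nhds (J := 𝓘(ℝ, ℝ).prod J) p] with y hy
  rw [localExtension_partialT S hy]

variable {ε : ℤˣ} {S : TopologicalSpace.Opens ℝ} {a : ℝ → ℝ}
  {ha : ContDiffOn ℝ ∞ a S} {hpos : ∀ t ∈ S, 0 < a t} {gP : SemiRiemannianMetric J P}

theorem warpedMetric_val (q : S × P) (V W : TangentSpace (𝓘(ℝ, ℝ).prod J) q) :
    (warpedMetric ε S a ha hpos gP).val q V W = ((ε : ℤ) : ℝ) * ((V : ℝ × F).1 * (W : ℝ × F).1)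
      + a (q.1 : ℝ) ^ 2 * gP.val q.2 (V : ℝ × F).2 (W : ℝ × F).2 := by
  simp only [warpedMetric, _root_.add_apply, _root_.smul_apply, pullbackForm_apply,
    ContinuousLinearMap.mul_apply', mvfderiv_timeCoord, mfderiv_snd, smul_eq_mul]
  rfl

theorem warpedMetric_val_partialT (q : S × P) (W : TangentSpace (𝓘(ℝ, ℝ).prod J) q) :
    (warpedMetric ε S a ha hpos gP).val q (partialT S q) W = ((ε : ℤ) : ℝ) * (W : ℝ × F).1 := by
  rw [warpedMetric_val]
  have h : gP.val q.2 (0 : F) (W : ℝ × F).2 = 0 := by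
    rw [show gP.val q.2 (0 : F) = 0 from map_zero _]; rfl
  change _ * (1 * _) + _ * gP.val q.2 (0 : F) _ = _
  rw [h]
  ring

/-- For coordinate fields, `⟨V, W⟩` is a constant plus `a²` times a function on `P`. Along `∂_t`
only `a²` varies, with derivative `2 a a'`. -/
theorem mvfderiv_warpedMetric_partialT (p : S × P) (V W : TangentSpace (𝓘(ℝ, ℝ).prod J) p) :
    mvfderiv (𝓘(ℝ, ℝ).prod J) (fun y ↦ (warpedMetric ε S a ha hpos gP).val y
        (localExtension V y) (localExtension W y)) p (partialT S p)
      = 2 * a (p.1 : ℝ) * deriv a (p.1 : ℝ) * gP.val p.2 (V : ℝ × F).2 (W : ℝ × F).2 := by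
  let K : P → ℝ := fun q ↦ gP.val q (localExtension (J := J) (x := p.2) (V : ℝ × F).2 q)
    (localExtension (J := J) (x := p.2) (W : ℝ × F).2 q)
  let α : S × P → ℝ := fun y ↦ a (timeCoord S y) ^ 2
  have e : (fun y ↦ (warpedMetric ε S a ha hpos gP).val y
        (localExtension V y) (localExtension W y)) =ᶠ[𝓝 p]
      (fun _ ↦ ((ε : ℤ) : ℝ) * ((V : ℝ × F).1 * (W : ℝ × F).1)) + α • (K ∘ Prod.snd) := by
    filter_upwards [trivializationAt_tangent_baseSet_mem_nhds (J := 𝓘(ℝ, ℝ).prod J) p] with y hy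
    rw [warpedMetric_val, localExtension_prod S hy, localExtension_prod S hy]
    rfl
  have hK : MDifferentiableAt J 𝓘(ℝ, ℝ) K p.2 :=
    gP.mdifferentiableAt_val_localExtension (x := p.2) _ _
  have hKs := hK.hasMFDerivAt.comp p (hasMFDerivAt_snd (I := 𝓘(ℝ, ℝ)) (I' := J) p)
  have had : HasDerivAt a (deriv a p.1) p.1 :=
    ((ha.contDiffAt (S.isOpen.mem_nhds p.1.2)).differentiableAt (by simp)).hasDerivAt
  have hα := (had.pow 2).hasFDerivAt.hasMFDerivAt.comp p (hasMFDerivAt_timeCoord (J := J) S p)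
  have hα' : MDifferentiableAt (𝓘(ℝ, ℝ).prod J) 𝓘(ℝ, ℝ) α p := hα.mdifferentiableAt
  rw [mvfderiv_congr e, mvfderiv_add mdifferentiableAt_const
    (hα'.smul hKs.mdifferentiableAt), mvfderiv_const, mvfderiv_smul hα' hKs.mdifferentiableAt]
  have h1 : mvfderiv (𝓘(ℝ, ℝ).prod J) (K ∘ Prod.snd) p (partialT S p) = 0 := by
    refine (congr($(hKs.mfderiv) _)).trans ?_
    exact map_zero (mfderiv J 𝓘(ℝ, ℝ) K p.2)
  have h2 : mvfderiv (𝓘(ℝ, ℝ).prod J) α p (partialT S p)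
      = 2 * a (p.1 : ℝ) * deriv a (p.1 : ℝ) := by
    refine (congr($(hα.mfderiv) _)).trans ?_
    change (1 : ℝ) * _ = _
    simp
  have h3 : (K ∘ Prod.snd) p = gP.val p.2 (V : ℝ × F).2 (W : ℝ × F).2 :=
    gP.val_localExtension_self (x := p.2) _ _
  simp only [zero_add, _root_.add_apply, _root_.smul_apply, ContinuousLinearMap.smulRight_apply,
    h1, h2, h3, smul_eq_mul]
  rw [mul_zero, zero_add]

/-- Koszul's formula leaves `⟨∇_V ∂_t, W⟩ = a a' g_P(V, W)`, and `a² g_P(V, W)` is `⟨V, W⟩` minus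
its time part `ε dt(V) dt(W)`. -/
theorem nabla_partialT
    {nabla : CovariantDerivative (𝓘(ℝ, ℝ).prod J) (ℝ × F)
      (TangentSpace (𝓘(ℝ, ℝ).prod J) : S × P → Type _)}
    (hnabla : IsLeviCivita (warpedMetric ε S a ha hpos gP) nabla) (p : S × P)
    (V : TangentSpace (𝓘(ℝ, ℝ).prod J) p) :
    nabla (partialT S) p V = (deriv a (p.1 : ℝ) / a (p.1 : ℝ)) •
      (V - (V : ℝ × F).1 • partialT S p) := by
  have hb := trivializationAt_tangent_baseSet_mem_nhds (J := 𝓘(ℝ, ℝ).prod J) p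
  have hc : nabla (partialT S) p = nabla (localExtension (partialT S p)) p :=
    nabla.isCovariantDerivativeOn.congr_of_eqOn (mdiffAt_partialT S p) (mdiffAt_localExtension _)
      hb fun y hy ↦ (localExtension_partialT S hy).symm
  have hconst (W U : TangentSpace (𝓘(ℝ, ℝ).prod J) p) :
      mvfderiv (𝓘(ℝ, ℝ).prod J) (fun y ↦ (warpedMetric ε S a ha hpos gP).val y
        (localExtension (partialT S p) y) (localExtension W y)) p U = 0 := by
    have e : (fun y ↦ (warpedMetric ε S a ha hpos gP).val y
        (localExtension (partialT S p) y) (localExtension W y)) =ᶠ[𝓝 p]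
        fun _ ↦ ((ε : ℤ) : ℝ) * (W : ℝ × F).1 := by
      filter_upwards [hb] with y hy
      rw [localExtension_partialT S hy, warpedMetric_val_partialT, localExtension_prod S hy]
    rw [mvfderiv_congr e, mvfderiv_const]
    rfl
  refine (warpedMetric ε S a ha hpos gP).eq_of_val_eq fun W ↦ ?_
  have hk := hnabla.koszul_localExtension V (partialT S p) W
  have hs : (fun y ↦ (warpedMetric ε S a ha hpos gP).val y
        (localExtension V y) (localExtension (partialT S p) y)) = fun y ↦
      (warpedMetric ε S a ha hpos gP).val y
        (localExtension (partialT S p) y) (localExtension V y) :=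
    funext fun y ↦ (warpedMetric ε S a ha hpos gP).symm y _ _
  -- The terms `V⟨∂_t, W⟩` and `W⟨V, ∂_t⟩` vanish; `∂_t⟨W, V⟩` remains.
  rw [hs, hconst, hconst, mvfderiv_warpedMetric_partialT, ← hc] at hk
  have ha0 : a (p.1 : ℝ) ≠ 0 := ne_of_gt (hpos _ p.1.2)
  have hr : (warpedMetric ε S a ha hpos gP).val p ((deriv a (p.1 : ℝ) / a (p.1 : ℝ)) •
      (V - (V : ℝ × F).1 • partialT S p)) W = (deriv a (p.1 : ℝ) / a (p.1 : ℝ)) *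
      ((warpedMetric ε S a ha hpos gP).val p V W
        - (V : ℝ × F).1 * (warpedMetric ε S a ha hpos gP).val p (partialT S p) W) := by
    simp
  rw [hr, warpedMetric_val_partialT, warpedMetric_val p V W]
  have hsy := gP.symm p.2 (W : ℝ × F).2 (V : ℝ × F).2
  rw [hsy] at hk
  field_simp
  linear_combination a (p.1 : ℝ) * hk / 2

end Warped

/-! ### Submanifolds of the warped product over a space form. -/

theorem lemma3p1 {n N l : ℕ} (hN : 2 ≤ N) (hl : l ≤ N) (c ε : ℤˣ) (p₀ : Quadric N l c)
    (S : TopologicalSpace.Opens ℝ) (hS : IsPreconnected (S : Set ℝ))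
    (a : ℝ → ℝ) (ha : ContDiffOn ℝ ∞ a S) (hpos : ∀ t ∈ S, 0 < a t)
    {M : Type*} [TopologicalSpace M] [ChartedSpace (EuclideanSpace ℝ (Fin n)) M]
    [IsManifold (𝓡 n) ∞ M] [T2Space M] [SecondCountableTopology M] [ConnectedSpace M]
    (g : SemiRiemannianMetric (𝓡 n) M)
    (f : IsometricImmersion g (warpedMetric ε S a ha hpos (SpaceForm.metric p₀)))
    (nabla : CovariantDerivative (𝓡 n) (EuclideanSpace ℝ (Fin n))
      (TangentSpace (𝓡 n) : M → Type _))
    (hnabla : IsLeviCivita g nabla)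
    (nablaBar : CovariantDerivative (𝓘(ℝ, ℝ).prod (𝓡 N)) (ℝ × EuclideanSpace ℝ (Fin N))
      (TangentSpace (𝓘(ℝ, ℝ).prod (𝓡 N)) : S × SpaceForm p₀ → Type _))
    (hnablaBar : IsLeviCivita (warpedMetric ε S a ha hpos (SpaceForm.metric p₀)) nablaBar)
    (pr : M → ℝ) (hpr : pr = fun x ↦ timeCoord S (f.toFun x))
    (T : Π x : M, TangentSpace (𝓡 n) x) (hT : T = fun x ↦ ((ε : ℤ) : ℝ) • g.grad pr x)
    (ξ : Π x : M, TangentSpace (𝓘(ℝ, ℝ).prod (𝓡 N)) (f.toFun x))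
    (hξ : ∀ x, partialT S (f.toFun x) = mfderiv (𝓡 n) (𝓘(ℝ, ℝ).prod (𝓡 N)) f.toFun x (T x) + ξ x)
    (x : M) (X : TangentSpace (𝓡 n) x) :
    f.IsNormal x (ξ x) ∧
    nablaBar (partialT S) (f.toFun x) (mfderiv (𝓡 n) (𝓘(ℝ, ℝ).prod (𝓡 N)) f.toFun x X)
      = (deriv a (pr x) / a (pr x)) •
        (mfderiv (𝓡 n) (𝓘(ℝ, ℝ).prod (𝓡 N)) f.toFun x X
          - (((ε : ℤ) : ℝ) * g.val x X (T x)) • partialT S (f.toFun x)) ∧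
    nabla T x X
      = (deriv a (pr x) / a (pr x)) • (X - (((ε : ℤ) : ℝ) * g.val x X (T x)) • T x)
        + f.shapeOperator nablaBar x (ξ x) X ∧
    f.normalConnection nablaBar ξ x X
      = -(((ε : ℤ) : ℝ) * deriv a (pr x) / a (pr x) * g.val x X (T x)) • ξ x
        - f.secondFundamentalForm nablaBar x X (T x) := by 
  have hpr_smooth : ContMDiff (𝓡 n) 𝓘(ℝ, ℝ) ∞ pr := by
    rw [hpr]
    exact (contMDiff_timeCoord S).comp f.contMDiff
  have hdpr (y : M) (v : TangentSpace (𝓡 n) y) : mvfderiv (𝓡 n) pr y v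
      = (mfderiv (𝓡 n) (𝓘(ℝ, ℝ).prod (𝓡 N)) f.toFun y v : ℝ × EuclideanSpace ℝ (Fin N)).1 := by
    rw [hpr]
    exact congr($(((hasMFDerivAt_timeCoord S (f.toFun y)).comp y
      ((f.contMDiff y).mdifferentiableAt (by simp)).hasMFDerivAt).mfderiv) v)
  have hTval (y : M) (v : TangentSpace (𝓡 n) y) : g.val y (T y) v
      = ((ε : ℤ) : ℝ) * (mfderiv (𝓡 n) (𝓘(ℝ, ℝ).prod (𝓡 N)) f.toFun y v :
          ℝ × EuclideanSpace ℝ (Fin N)).1 := by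
    rw [← hdpr, hT, map_smul, _root_.smul_apply, SemiRiemannianMetric.grad, g.val_sharp]
    rfl
  have hnormal (y : M) : f.IsNormal y (ξ y) := fun v ↦ by
    have h1 : ξ y = partialT S (f.toFun y)
        - mfderiv (𝓡 n) (𝓘(ℝ, ℝ).prod (𝓡 N)) f.toFun y (T y) := by
      rw [hξ y]; abel
    rw [h1, map_sub, _root_.sub_apply, f.isometric, hTval, warpedMetric_val_partialT, sub_self]
  have hTd : MDifferentiableAt (𝓡 n) (𝓡 n).tangent
      (fun y ↦ TotalSpace.mk' (EuclideanSpace ℝ (Fin n)) y (T y)) x := by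
    -- A vector field on `M` is a field along the identity map.
    have h := mdiffAt_along_smul (f := id) (h := fun _ : M ↦ ((ε : ℤ) : ℝ))
      mdifferentiableAt_const (g.mdiffAt_grad hpr_smooth x)
    rw [hT]
    exact h
  -- Since `ε² = 1`, the time component of `df X` is `ε⟨X, T⟩`. This converts `nabla_partialT` into
  -- formula 1.
  have hε : ((ε : ℤ) : ℝ) * g.val x X (T x)
      = (mfderiv (𝓡 n) (𝓘(ℝ, ℝ).prod (𝓡 N)) f.toFun x X : ℝ × EuclideanSpace ℝ (Fin N)).1 := by
    rw [g.symm, hTval, ← mul_assoc, Quadric.coe_mul_self, one_mul]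
  have hprx : pr x = ((f.toFun x).1 : ℝ) := by rw [hpr]; rfl
  have hbar := nabla_partialT hnablaBar (f.toFun x)
    (mfderiv (𝓡 n) (𝓘(ℝ, ℝ).prod (𝓡 N)) f.toFun x X)
  rw [← hε, ← hprx] at hbar
  obtain ⟨htan, hnor⟩ := f.derivative_of_restriction hnabla hnablaBar
    (mdiffAt_partialT S (f.toFun x)) hTd hnormal hξ X
  -- Substituting `∂_t = T + ξ` in formula 1, the tangential part keeps `X` and `T`, the normal part
  -- only `ξ`.
  rw [hbar, hξ x] at htan hnor
  simp only [map_smul, map_sub, map_add, f.tangential_mfderiv, f.normal_mfderiv,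
    f.tangential_of_isNormal (hnormal x), f.normal_of_isNormal (hnormal x), zero_add, add_zero,
    zero_sub] at htan hnor
  refine ⟨hnormal x, hbar, ?_, ?_⟩
  · rw [htan]
    abel
  · rw [eq_sub_iff_add_eq', ← hnor, smul_neg, smul_smul, ← neg_smul]
    congr 1
    ring
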